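/- **Setting.** Let $M=(S,A,P)$ be a finite MDP with $|S|\ge 2$, $|A|\ge 1$, known transition probabilities $P(s,a,s')$ and a known initial state distribution $d_1$. Its diameter is $D=\max_{s\ne s'}\min_\pi \mathbb{E}[T(s'\mid M,\pi,s)]$, where $\pi$ ranges over the stationary (randomised) policies and $T(s'\mid M,\pi,s)$ is the first time at which $s'$ is reached from $s$ under $\pi$. Assume that $M$ is communicating ($D<\infty$) and that some state $s^*$ has an action $a$ with $P(s^*,a,s^*)=1$. An oblivious adversary chooses losses $\ell_1,\dots,\ell_T:S\times A\to[0,1]$, and $\ell_t$ is revealed after round $t$. Let $\Pi=A^S$ be the set of stationary deterministic policies. For $\pi\in\Pi$ let $d_\pi^t$ be the law of the state in round $t$ under $\pi$ (so $d^1_\pi=d_1$), $\hat\ell_t(\pi)=\sum_s d_\pi^t(s)\,\ell_t(s,\pi(s))$, $L^\pi=\sum_{t\le T}\hat\ell_t(\pi)$ and $L^*=\min_{\pi\in\Pi}L^\pi$. The regret of an algorithm is $\mathbb{E}[\sum_{t\le T}\ell_t(s_t,a_t)]-L^*$. **Algorithm.** *FPL with parameter $\lambda$*: draw independent exponential variables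 $\varepsilon_\pi$ ($\pi\in\Pi$) with parameter $\lambda$ once, and recommend in round $t$ a policy $\pi_t\in\arg\min_{\pi\in\Pi}\bigl(\sum_{i<t}\hat\ell_i(\pi)-\varepsilon_\pi\bigr)$. *Main*: start by following $\pi_1$, and follow the recommended policy as long as it does not change. Whenever $\pi_t\neq\pi_{t-1}$, (re)start the following procedure with $\pi=\pi_t$, abandoning any earlier run of it. *Switch_Policy*: repeat until done: (1) from the current state $s$, move to $s^*$ with a stationary policy that minimises the expected time to reach $s^*$ from $s$ (no step is made if $s=s^*$); (2) being at $s^*$ in round $t$, draw a target $g\sim d_\pi^{t+\ell^*}$ and make $\ell^*$ steps with the non-stationary policy $\pi_g$; (3) if the state is then $g$, with probability $p^*/p_g$ stop and follow $\pi$ from now on. Here $\ell^*\in\mathbb{N}$ and the policies $(\pi_g)_{g\in S}$ are such that $\ell^*\le 2D$ and, for every $g\in S$, the probability $p_g$ of being in $g$ after exactly $\ell^*$ steps from $s^*$ with $\pi_g$ is at least $1/(4D)$; $p^*=\min_g p_g$. **Theorem.** Policies for the moves to $s^*$, a number $\ell^*$ and policies $(\pi_g)_{g\in S}$ as required exist.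 Moreover, there is an absolute constant $C>0$ such that, for all $M$, $d_1$, $s^*$ as above, all admissible choices of these policies and of $\ell^*$, all $T$ and all $\ell_1,\dots,\ell_T$, the following holds, where $\lambda(\Lambda)=\frac12\sqrt{b/\max\{\Lambda,b\}}$ with $b=1+|S|\log|A|$. 1. The regret of the algorithm with $\lambda=\lambda(T)$ is at most $C\,D^2\sqrt{T\,|S|\log|A|}$. 2. The regret of the algorithm with $\lambda=\lambda(L^*)$ is at most $C\,D^2\sqrt{L^*\,|S|\log|A|}$ whenever $L^*\ge|S|\log|A|$, and in all cases at most $C\,D^2\bigl(\sqrt{L^*\,|S|\log|A|}+|S|\log|A|\bigr)$. -/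

import Mathlib

open MeasureTheory ProbabilityTheory
open scoped ENNReal

/-- A Markov decision process with state space `S`, action space `A` and transition
probabilities `P s a s'`. -/
structure MDP (S A : Type*) where
  P : S → A → PMF S

noncomputable section

namespace MDP

variable {S A : Type*}

/-! ### Policies and state distributions

A stationary (randomised) policy is a map `S → PMF A`, a stationary deterministic policy is a map
`S → A`, and a (possibly) non-stationary Markov policy is a map `ℕ → S → PMF A`, the first argument
being the number of steps made so far. Time is counted from `0`, so that time `t` here is
round `t + 1` of the interaction. -/

/-- The law of the state after `n` steps, when the initial state has law `μ` and the actions are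
chosen by the Markov policy `π`. -/
def stateLaw (M : MDP S A) (μ : PMF S) (π : ℕ → S → PMF A) : ℕ → PMF S
  | 0 => μ
  | n + 1 => (stateLaw M μ π n).bind fun s => (π n s).bind fun a => M.P s a

/-- The distribution `d_π^t` of the state at time `t` under the stationary deterministic
policy `π`, with initial distribution `d₁`. -/
def detLaw (M : MDP S A) (d₁ : PMF S) (π : S → A) (t : ℕ) : PMF S :=
  M.stateLaw d₁ (fun _ s => PMF.pure (π s)) t

/-! ### Hitting times, diameter -/

open Classical in
/-- `Pr[T > n]`, where `T = min {k ≥ 0 | s_k = g}` is the first time at which the state `g` is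
reached, when one starts at `s` and follows the stationary policy `π`. -/
def notHitProb [Fintype S] [Fintype A] (M : MDP S A) (π : S → PMF A) (g : S) : ℕ → S → ℝ≥0∞
  | 0, s => if s = g then 0 else 1
  | n + 1, s =>
      if s = g then 0 else ∑ a, π s a * ∑ s', M.P s a s' * notHitProb M π g n s'

/-- The expected hitting time `𝔼[T] = ∑_{n ≥ 0} Pr[T > n]` of `g` from `s` under `π`; it is `∞` if
`g` is missed with positive probability. -/
def expHit [Fintype S] [Fintype A] (M : MDP S A) (π : S → PMF A) (s g : S) : ℝ≥0∞ :=
  ∑' n, M.notHitProb π g n s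

/-- The diameter: the largest, over pairs of distinct states, of the least expected hitting time
over stationary policies. -/
def ediam [Fintype S] [Fintype A] (M : MDP S A) : ℝ≥0∞ :=
  ⨆ (s : S) (s' : S) (_ : s ≠ s'), ⨅ π : S → PMF A, M.expHit π s s'

def Communicating [Fintype S] [Fintype A] (M : MDP S A) : Prop := M.ediam < ∞

/-- The diameter as a real number (meaningful for communicating MDPs). -/
def diam [Fintype S] [Fintype A] (M : MDP S A) : ℝ := M.ediam.toReal

/-! ### Losses of policies -/

/-- `𝔼[ℓ_t(s_t, a_t)]` when the stationary deterministic policy `π` is followed from the start. -/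
def hatLoss [Fintype S] (M : MDP S A) (d₁ : PMF S) (ℓ : ℕ → S → A → ℝ) (t : ℕ) (π : S → A) : ℝ :=
  ∑ s, (M.detLaw d₁ π t s).toReal * ℓ t s (π s)

/-- The expected loss `L^π` of a stationary deterministic policy in `T` rounds. -/
def policyLoss [Fintype S] (M : MDP S A) (d₁ : PMF S) (ℓ : ℕ → S → A → ℝ) (T : ℕ)
    (π : S → A) : ℝ :=
  ∑ t ∈ Finset.range T, M.hatLoss d₁ ℓ t π

/-- The expected loss `L^*` of the best stationary deterministic policy in hindsight. -/
def bestLoss [Fintype S] (M : MDP S A) (d₁ : PMF S) (ℓ : ℕ → S → A → ℝ) (T : ℕ) : ℝ :=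
  ⨅ π : S → A, M.policyLoss d₁ ℓ T π

/-! ### Follow the perturbed leader over the stationary deterministic policies -/

open Classical in
/-- The set of minimisers of a function on a finite type. -/
def argminSet {E : Type*} [Fintype E] (f : E → ℝ) : Finset E :=
  Finset.univ.filter fun e => ∀ e', f e ≤ f e'

theorem argminSet_nonempty {E : Type*} [Fintype E] [Nonempty E] (f : E → ℝ) :
    (argminSet f).Nonempty := by
  classical
  obtain ⟨e, he⟩ := Finite.exists_min f
  exact ⟨e, by simpa [argminSet] using he⟩

/-- A minimiser of `f`; which of several minimisers is taken depends on the set of minimisers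
only. -/
def argmin {E : Type*} [Fintype E] [Nonempty E] (f : E → ℝ) : E :=
  (argminSet_nonempty f).choose

open Classical in
/-- The policy chosen by FPL at time `t`, given the perturbations `ε`, which are drawn once and
subtracted from the cumulative losses of the policies in the previous rounds. -/
def fpl [Fintype S] [Fintype A] [Nonempty A] (M : MDP S A) (d₁ : PMF S) (ℓ : ℕ → S → A → ℝ)
    (ε : (S → A) → ℝ) (t : ℕ) : S → A :=
  argmin fun π => M.policyLoss d₁ ℓ t π - ε π

open Classical in
/-- The law of the perturbations: independent exponential variables with parameter `rate`, one
for each stationary deterministic policy. -/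
def fplNoise (S A : Type*) [Fintype S] [Fintype A] (rate : ℝ) : Measure ((S → A) → ℝ) :=
  Measure.pi fun _ => expMeasure rate

/-! ### The algorithm -/

/-- What the procedure for catching a policy uses: when called to move to `s^*` from the state `s`,
it follows the stationary policy `home s`; after `s^*` has been reached and a target `g` has been
drawn, it makes `len` steps with the non-stationary policy `chase g`. -/
structure CatchPlan (S A : Type*) where
  home : S → S → PMF A
  len : ℕ
  chase : S → ℕ → S → PMF A

/-- `p_g`: the probability of being in the target state `g` after `len` steps from `s^*`. -/
def catchProb (M : MDP S A) (sstar : S) (plan : CatchPlan S A) (g : S) : ℝ≥0∞ :=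
  M.stateLaw (PMF.pure sstar) (plan.chase g) plan.len g

/-- `p^* = min_g p_g`. -/
def catchProbMin (M : MDP S A) (sstar : S) (plan : CatchPlan S A) : ℝ≥0∞ :=
  ⨅ g, M.catchProb sstar plan g

/-- The requirements on the policies used for catching: `home s` is a best policy for moving from
`s` to `s^*`; the common length `len` is at most `2 D`, and each target is met after exactly
`len` steps with probability at least `1 / (4 D)`. -/
structure CatchPlan.IsAdmissible [Fintype S] [Fintype A] (plan : CatchPlan S A) (M : MDP S A)
    (sstar : S) : Prop where
  home_best : ∀ s, s ≠ sstar → ∀ π : S → PMF A,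
    M.expHit (plan.home s) s sstar ≤ M.expHit π s sstar
  len_le : (plan.len : ℝ) ≤ 2 * M.diam
  le_catchProb : ∀ g, 1 / (4 * M.diam) ≤ (M.catchProb sstar plan g).toReal

/-- What the algorithm is doing: following the policy currently recommended by FPL; moving to
`s^*`, the move having started in `s₀`; or having made `k` steps towards the target `g`
since it left `s^*`. -/
inductive Mode (S : Type*)
  | follow : Mode S
  | home (s₀ : S) : Mode S
  | chase (k : ℕ) (g : S) : Mode S

/-- A coin that shows `true` with probability `p`. -/
def coin (p : ℝ≥0∞) (hp : p ≤ 1) : PMF Bool :=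
  PMF.ofFintype (fun b => cond b p (1 - p)) (by simp [hp])

theorem catchProbMin_div_le_one (M : MDP S A) (sstar : S) (plan : CatchPlan S A) (g : S) :
    M.catchProbMin sstar plan / M.catchProb sstar plan g ≤ 1 :=
  ENNReal.div_le_of_le_mul (by rw [one_mul]; exact iInf_le _ g)

open Classical in
/-- One pass through the head of the loop of the catching procedure for the policy `π`, at time `t`
in state `s`: if `s = s^*`, draw the target from `d_π^{t + len}` and start to chase it;
otherwise start to move to `s^*`. -/
def tryCatch (M : MDP S A) (d₁ : PMF S) (sstar : S) (plan : CatchPlan S A)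
    (π : S → A) (t : ℕ) (s : S) : PMF (Mode S) :=
  if s = sstar then (M.detLaw d₁ π (t + plan.len)).map (Mode.chase 0)
  else PMF.pure (Mode.home s)

/-- The law of the action in state `s`, when FPL currently recommends `π`. -/
def actionLaw (plan : CatchPlan S A) (π : S → A) (s : S) : Mode S → PMF A
  | .follow => PMF.pure (π s)
  | .home s₀ => plan.home s₀ s
  | .chase k g => plan.chase g k s

open Classical in
/-- The law of the mode at time `t`, given the new state `s`, the mode at time `t - 1` and the
policies `π'` and `π` recommended by FPL at times `t - 1` and `t`. When FPL switches, the
catching procedure is (re)started. At the end of a chase that has met its target `g`, the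
policy `π` is followed from now on with probability `p^* / p_g`; otherwise the loop of the
catching procedure continues. -/
def nextMode (M : MDP S A) (d₁ : PMF S) (sstar : S) (plan : CatchPlan S A)
    (π' π : S → A) (t : ℕ) (s : S) (m : Mode S) : PMF (Mode S) :=
  if π = π' then
    match m with
    | .follow => PMF.pure .follow
    | .home s₀ =>
        if s = sstar then M.tryCatch d₁ sstar plan π t s else PMF.pure (.home s₀)
    | .chase k g =>
        if k + 1 < plan.len then PMF.pure (.chase (k + 1) g)
        else if s = g then
          (coin _ (M.catchProbMin_div_le_one sstar plan g)).bind fun I =>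
            if I = true then PMF.pure .follow else M.tryCatch d₁ sstar plan π t s
        else M.tryCatch d₁ sstar plan π t s
  else M.tryCatch d₁ sstar plan π t s

/-- The law of the state and the mode at time `t`, when `seq t` is the policy recommended by FPL
at time `t`. -/
def configLaw (M : MDP S A) (d₁ : PMF S) (sstar : S) (plan : CatchPlan S A) (seq : ℕ → S → A) :
    ℕ → PMF (S × Mode S)
  | 0 => d₁.map fun s => (s, Mode.follow)
  | t + 1 =>
      (configLaw M d₁ sstar plan seq t).bind fun c =>
        (actionLaw plan (seq t) c.1 c.2).bind fun a =>
          (M.P c.1 a).bind fun s =>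
            (M.nextMode d₁ sstar plan (seq t) (seq (t + 1)) (t + 1) s c.2).map fun m => (s, m)

/-- The joint law of the state and the action at time `t`. -/
def stateActionLaw (M : MDP S A) (d₁ : PMF S) (sstar : S) (plan : CatchPlan S A)
    (seq : ℕ → S → A) (t : ℕ) : PMF (S × A) :=
  (M.configLaw d₁ sstar plan seq t).bind fun c =>
    (actionLaw plan (seq t) c.1 c.2).map fun a => (c.1, a)

/-- The conditional expectation of `∑_{t < T} ℓ_t(s_t, a_t)` for the algorithm, given the policies
recommended by FPL (which do not depend on the visited states and actions). -/
def lossGiven [Fintype S] [Fintype A] (M : MDP S A) (d₁ : PMF S) (sstar : S)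
    (plan : CatchPlan S A) (ℓ : ℕ → S → A → ℝ) (T : ℕ) (seq : ℕ → S → A) : ℝ :=
  ∑ t ∈ Finset.range T, ∑ x : S × A,
    (M.stateActionLaw d₁ sstar plan seq t x).toReal * ℓ t x.1 x.2

theorem measurable_fpl_comp [Fintype S] [Fintype A] [Nonempty A] (M : MDP S A) (d₁ : PMF S)
    (ℓ : ℕ → S → A → ℝ) (t : ℕ) : Measurable[_, ⊤] fun ε => M.fpl d₁ ℓ ε t := by
  classical
  let _ : MeasurableSpace (S → A) := ⊤
  let _ : MeasurableSpace (Finset (S → A)) := ⊤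
  have h1 : Measurable fun ε : (S → A) → ℝ =>
      argminSet fun π => M.policyLoss d₁ ℓ t π - ε π := by
    refine measurable_to_countable' fun F => ?_
    have : (fun ε : (S → A) → ℝ => argminSet fun π => M.policyLoss d₁ ℓ t π - ε π) ⁻¹' {F}
        = ⋂ π : S → A, {ε | π ∈ F ↔ ∀ π', M.policyLoss d₁ ℓ t π - ε π
            ≤ M.policyLoss d₁ ℓ t π' - ε π'} := by
      ext ε
      simp only [Set.mem_preimage, Set.mem_singleton_iff, Set.mem_iInter, Set.mem_ofPred_eq,
        Finset.ext_iff, argminSet, Finset.mem_filter, Finset.mem_univ, true_and]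
      exact forall_congr' fun _ => Iff.comm
    rw [this]
    refine MeasurableSet.iInter fun π => ?_
    have hm : MeasurableSet {ε : (S → A) → ℝ | ∀ π', M.policyLoss d₁ ℓ t π - ε π
            ≤ M.policyLoss d₁ ℓ t π' - ε π'} := by
      rw [Set.ofPred_forall]
      exact MeasurableSet.iInter fun π' => measurableSet_le (by fun_prop) (by fun_prop)
    by_cases hF : π ∈ F
    · simpa [hF] using hm
    · simp only [hF, false_iff]
      exact hm.compl
  have h2 : Measurable fun F : Finset (S → A) =>
      if h : F.Nonempty then h.choose else Classical.arbitrary _ := measurable_from_top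
  have h3 : (fun ε => M.fpl d₁ ℓ ε t) = (fun F : Finset (S → A) =>
      if h : F.Nonempty then h.choose else Classical.arbitrary _) ∘ fun ε : (S → A) → ℝ =>
      argminSet fun π => M.policyLoss d₁ ℓ t π - ε π := by
    funext ε
    simp only [Function.comp, fpl, argmin]
    rw [dif_pos (argminSet_nonempty _)]
  rw [h3]
  exact h2.comp h1

theorem configLaw_congr (M : MDP S A) (d₁ : PMF S) (sstar : S) (plan : CatchPlan S A)
    {seq seq' : ℕ → S → A} (t : ℕ) (h : ∀ i ≤ t, seq i = seq' i) :
    M.configLaw d₁ sstar plan seq t = M.configLaw d₁ sstar plan seq' t := by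
  induction t with
  | zero => rfl
  | succ t ih =>
    simp only [configLaw]
    rw [ih fun i hi => h i (by omega), h t (by omega), h (t + 1) le_rfl]

theorem lossGiven_congr [Fintype S] [Fintype A] (M : MDP S A) (d₁ : PMF S) (sstar : S)
    (plan : CatchPlan S A) (ℓ : ℕ → S → A → ℝ) (T : ℕ)
    {seq seq' : ℕ → S → A} (h : ∀ i < T, seq i = seq' i) :
    M.lossGiven d₁ sstar plan ℓ T seq = M.lossGiven d₁ sstar plan ℓ T seq' := by
  refine Finset.sum_congr rfl fun t ht => ?_
  have ht := Finset.mem_range.1 ht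
  rw [stateActionLaw, stateActionLaw, configLaw_congr M d₁ sstar plan t
    fun i hi => h i (by omega), h t ht]

/-- The integral that defines `algLoss` exists. -/
theorem integrable_lossGiven [Fintype S] [Fintype A] [Nonempty A] (M : MDP S A) (d₁ : PMF S)
    (sstar : S) (plan : CatchPlan S A) {rate : ℝ} (hrate : 0 < rate) (ℓ : ℕ → S → A → ℝ) (T : ℕ) :
    Integrable (fun ε => M.lossGiven d₁ sstar plan ℓ T (M.fpl d₁ ℓ ε)) (fplNoise S A rate) := by
  have _ : IsProbabilityMeasure (expMeasure rate) := isProbabilityMeasure_expMeasure hrate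
  have _ : IsProbabilityMeasure (fplNoise S A rate) := by unfold fplNoise; infer_instance
  let G : (Fin T → S → A) → ℝ := fun σ => M.lossGiven d₁ sstar plan ℓ T
    fun i => if h : i < T then σ ⟨i, h⟩ else Classical.arbitrary _
  have hG : (fun ε => M.lossGiven d₁ sstar plan ℓ T (M.fpl d₁ ℓ ε))
      = fun ε => G fun i => M.fpl d₁ ℓ ε i := by
    funext ε
    exact lossGiven_congr M d₁ sstar plan ℓ T fun i hi => by rw [dif_pos hi]
  rw [hG]
  clear_value G
  obtain ⟨B, hB⟩ : ∃ B, ∀ σ, ‖G σ‖ ≤ B := by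
    obtain ⟨σ₀, h⟩ := Finite.exists_max fun σ => ‖G σ‖
    exact ⟨_, h⟩
  have hGm : Measurable fun ε : (S → A) → ℝ => G fun i => M.fpl d₁ ℓ ε i := by
    let _ : MeasurableSpace (S → A) := ⊤
    have hm : Measurable fun (ε : (S → A) → ℝ) (i : Fin T) => M.fpl d₁ ℓ ε i :=
      measurable_pi_lambda _ fun i => M.measurable_fpl_comp d₁ ℓ i
    exact (measurable_of_finite G).comp hm
  exact Integrable.of_bound hGm.aestronglyMeasurable B (Filter.Eventually.of_forall fun ε => hB _)

/-- The expected loss of the algorithm in `T` rounds, FPL being run with exponential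
perturbations of parameter `rate`. -/
def algLoss [Fintype S] [Fintype A] [Nonempty A] (M : MDP S A) (d₁ : PMF S) (sstar : S)
    (plan : CatchPlan S A) (rate : ℝ) (ℓ : ℕ → S → A → ℝ) (T : ℕ) : ℝ :=
  ∫ ε, M.lossGiven d₁ sstar plan ℓ T (M.fpl d₁ ℓ ε) ∂(fplNoise S A rate)

/-- The regret of the algorithm against the stationary deterministic policies. -/
def regret [Fintype S] [Fintype A] [Nonempty A] (M : MDP S A) (d₁ : PMF S) (sstar : S)
    (plan : CatchPlan S A) (rate : ℝ) (ℓ : ℕ → S → A → ℝ) (T : ℕ) : ℝ :=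
  M.algLoss d₁ sstar plan rate ℓ T - M.bestLoss d₁ ℓ T

end MDP

/-- `|S| log |A| = log |Π|`, where `Π` is the set of stationary deterministic policies. -/
def logPolicies (S A : Type*) [Fintype S] [Fintype A] : ℝ :=
  (Fintype.card S : ℝ) * Real.log (Fintype.card A : ℝ)

/-- The FPL parameter tuned for a total loss `Λ`, that is
`½ min {1, √((1 + |S| log |A|) / Λ)}` (which is `½` for `Λ = 0`). -/
def fplRate (S A : Type*) [Fintype S] [Fintype A] (Λ : ℝ) : ℝ :=
  √((1 + logPolicies S A) / max Λ (1 + logPolicies S A)) / 2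

theorem logPolicies_nonneg (S A : Type*) [Fintype S] [Fintype A] : 0 ≤ logPolicies S A :=
  mul_nonneg (Nat.cast_nonneg _) (Real.log_natCast_nonneg _)

theorem fplRate_pos (S A : Type*) [Fintype S] [Fintype A] (Λ : ℝ) : 0 < fplRate S A Λ := by
  have h := logPolicies_nonneg S A
  have h1 : 0 < 1 + logPolicies S A := by linarith
  have h2 : 0 < max Λ (1 + logPolicies S A) := lt_max_of_lt_right h1
  unfold fplRate
  positivity

end

/-! The adversary is oblivious and the losses fed to FPL use only known laws, so the recommendations
depend on the perturbations alone. The algorithm is therefore analysed for a fixed sequence of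
recommendations, and the perturbations are integrated out afterwards.

For a fixed sequence, catching a policy is rejection sampling. A chase of `g` arrives in `g` with
probability `p_g` and is then accepted with probability `p^* / p_g`, so it succeeds with probability
`p^*` whatever `g` is. Acceptance thus does not bias the target, and on success the state has the
law `d_π` of the current time. By induction, the law of the state restricted to the event of
following is a multiple of `d_π^t` (`exists_configLaw_follow`). Hence the loss exceeds the sum of
the losses `hatLoss` of the recommended policies by at most the expected number of idle rounds. An
attempt takes at most `D + 2 D` rounds in expectation and succeeds with probability at least `1 / (4
D)`; a potential function turns this into at most `13 D ^ 2` idle rounds per switch (`sum_idle_le`,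
`lossGiven_le`).

For FPL, shifting one exponential perturbation by `x` costs a factor of at most `exp (r x)` in
probability. So a leader loses the lead with conditional probability at most `r` times its next
loss, and the number of switches is at most `r` times the loss of FPL (`integral_fpl_switch_le`). By
the same shift, FPL loses at most `exp r` times what the leader that already knows the next loss
does, and that leader exceeds `L^*` by at most the mean of the largest perturbation
(`sum_integral_hatLoss_fpl_le`). Together this gives `regret_le`, whose terms `r L^*` and `(1 + log
|Π|) / r` are balanced by the choice of the rate.

Admissible plans exist because a target with expected hitting time at most `D` is occupied with
probability at least `1 / (4 D)` at some exact time up to `⌊2 D⌋`, and waiting at `s^*` beforehand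
makes all chases equally long. -/

/-! ### Expectations under probability mass functions -/

/-- The expectation of a nonnegative function. -/
noncomputable def PMF.lexp {α : Type*} (p : PMF α) (f : α → ℝ≥0∞) : ℝ≥0∞ := ∑' x, p x * f x

namespace PMF

variable {α β : Type*}

theorem lexp_pure (a : α) (f : α → ℝ≥0∞) : (PMF.pure a).lexp f = f a := by
  classical
  rw [lexp, tsum_eq_single a]
  · simp
  · intro b hb
    simp [PMF.pure_apply, hb]

theorem lexp_bind (p : PMF α) (q : α → PMF β) (f : β → ℝ≥0∞) :
    (p.bind q).lexp f = p.lexp fun a => (q a).lexp f := by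
  simp only [lexp, PMF.bind_apply, ← ENNReal.tsum_mul_right, ← ENNReal.tsum_mul_left]
  rw [ENNReal.tsum_comm]
  simp only [mul_assoc]

theorem lexp_map (p : PMF α) (g : α → β) (f : β → ℝ≥0∞) :
    (p.map g).lexp f = p.lexp fun a => f (g a) := by
  rw [← PMF.bind_pure_comp, lexp_bind]
  simp [lexp_pure]

theorem lexp_mono (p : PMF α) {f g : α → ℝ≥0∞} (h : ∀ a, f a ≤ g a) : p.lexp f ≤ p.lexp g :=
  ENNReal.tsum_le_tsum fun a => mul_le_mul_right (h a) _

theorem lexp_add (p : PMF α) (f g : α → ℝ≥0∞) :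
    (p.lexp fun a => f a + g a) = p.lexp f + p.lexp g := by
  simp only [lexp, mul_add, ENNReal.tsum_add]

theorem lexp_const (p : PMF α) (c : ℝ≥0∞) : (p.lexp fun _ => c) = c := by
  simp [lexp, ENNReal.tsum_mul_right, p.tsum_coe]

theorem lexp_const_mul (p : PMF α) (c : ℝ≥0∞) (f : α → ℝ≥0∞) :
    (p.lexp fun a => c * f a) = c * p.lexp f := by
  simp only [lexp, ← ENNReal.tsum_mul_left, mul_left_comm]

theorem lexp_le_const (p : PMF α) {f : α → ℝ≥0∞} {c : ℝ≥0∞} (h : ∀ a, f a ≤ c) :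
    p.lexp f ≤ c :=
  (p.lexp_mono h).trans_eq (p.lexp_const c)

theorem lexp_tsum {ι : Type*} (p : PMF α) (f : ι → α → ℝ≥0∞) :
    (p.lexp fun a => ∑' i, f i a) = ∑' i, p.lexp (f i) := by
  simp only [lexp, ← ENNReal.tsum_mul_left]
  rw [ENNReal.tsum_comm]

theorem bind_apply_eq_lexp (p : PMF α) (q : α → PMF β) (b : β) :
    p.bind q b = p.lexp fun a => q a b := rfl

open Classical in
theorem map_apply_eq_lexp (p : PMF α) (g : α → β) (b : β) :
    p.map g b = p.lexp fun a => if g a = b then 1 else 0 := by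
  rw [PMF.map_apply, lexp]
  refine tsum_congr fun a => ?_
  by_cases h : g a = b
  · simp [h]
  · simp [h, Ne.symm h]

end PMF

namespace MDP

variable {S A : Type*}

theorem lexp_coin (p : ℝ≥0∞) (hp : p ≤ 1) (f : Bool → ℝ≥0∞) :
    (coin p hp).lexp f = p * f true + (1 - p) * f false := by
  rw [PMF.lexp, tsum_fintype, Fintype.sum_bool]
  simp [coin]

/-! ### Hitting times -/

open Classical in
theorem notHitProb_succ [Fintype S] [Fintype A] (M : MDP S A) (π : S → PMF A) (g : S) (n : ℕ)
    (s : S) : M.notHitProb π g (n + 1) s =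
      if s = g then 0 else (π s).lexp fun a => (M.P s a).lexp (M.notHitProb π g n) := by
  simp [notHitProb, PMF.lexp, tsum_fintype]

theorem expHit_self [Fintype S] [Fintype A] (M : MDP S A) (π : S → PMF A) (g : S) :
    M.expHit π g g = 0 := by
  simp only [expHit, ENNReal.tsum_eq_zero]
  intro n
  cases n <;> simp [notHitProb]

/-- In the sum of the tail probabilities the term for `n = 0` is `1`, and the others unfold by one
step. -/
theorem expHit_eq [Fintype S] [Fintype A] (M : MDP S A) (π : S → PMF A) {s g : S} (h : s ≠ g) :
    M.expHit π s g = 1 + (π s).lexp fun a => (M.P s a).lexp fun s' => M.expHit π s' g := by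
  rw [expHit, tsum_eq_zero_add' ENNReal.summable]
  congr 1
  · simp [notHitProb, h]
  · simp only [expHit, PMF.lexp_tsum]
    refine tsum_congr fun n => ?_
    simp [notHitProb_succ, h]

theorem one_le_expHit [Fintype S] [Fintype A] (M : MDP S A) (π : S → PMF A) {s g : S}
    (h : s ≠ g) : 1 ≤ M.expHit π s g := by
  rw [expHit_eq M π h]
  exact le_self_add

theorem one_le_ediam [Fintype S] [Fintype A] [Nontrivial S] (M : MDP S A) : 1 ≤ M.ediam := by
  obtain ⟨s, s', h⟩ := exists_pair_ne S
  refine le_trans (le_iInf fun π => M.one_le_expHit π h) ?_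
  exact le_iSup_of_le s (le_iSup_of_le s' (le_iSup_of_le h le_rfl))

/-! ### The expected duration of the catching procedure -/

open Classical in
/-- The probability that a chase of `g` that has `j` more steps to go and has arrived in `s` does
not end the catching procedure. -/
noncomputable def catchFail (M : MDP S A) (sstar : S) (plan : CatchPlan S A) (g : S) : ℕ → S → ℝ≥0∞
  | 0, s => if s = g then 1 - M.catchProbMin sstar plan / M.catchProb sstar plan g else 1
  | j + 1, s => (plan.chase g (plan.len - (j + 1)) s).lexp fun a =>
      (M.P s a).lexp (catchFail M sstar plan g j)

/-- `catchFail` solves the backward equation of the chase, so its mean along the chase is the same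
after every step. -/
theorem catchFail_start_aux (M : MDP S A) (sstar : S) (plan : CatchPlan S A) (g : S) {k : ℕ}
    (hk : k ≤ plan.len) :
    (M.stateLaw (PMF.pure sstar) (plan.chase g) k).lexp
      (M.catchFail sstar plan g (plan.len - k)) = M.catchFail sstar plan g plan.len sstar := by
  induction k with
  | zero => simp [stateLaw, PMF.lexp_pure]
  | succ k ih =>
    rw [← ih (by omega)]
    obtain ⟨j, hj⟩ : ∃ j, plan.len - k = j + 1 := ⟨plan.len - (k + 1), by omega⟩
    have h1 : plan.len - (k + 1) = j := by omega
    have h2 : plan.len - (j + 1) = k := by omega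
    simp only [stateLaw, PMF.lexp_bind, hj, h1, catchFail, h2]

/-- Success has probability `p_g * (p^* / p_g) = p^*`, which no longer depends on the target. -/
theorem catchFail_start [Finite S] (M : MDP S A) (sstar : S) (plan : CatchPlan S A) (g : S)
    (hg : M.catchProb sstar plan g ≠ 0) :
    M.catchFail sstar plan g plan.len sstar = 1 - M.catchProbMin sstar plan := by
  classical
  rw [← M.catchFail_start_aux sstar plan g le_rfl, Nat.sub_self]
  set q := M.stateLaw (PMF.pure sstar) (plan.chase g) plan.len with hq
  set x := M.catchProbMin sstar plan / M.catchProb sstar plan g with hx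
  have hx1 : x ≤ 1 := M.catchProbMin_div_le_one sstar plan g
  have hgt : M.catchProb sstar plan g ≠ ∞ := PMF.apply_ne_top _ _
  have hmin : M.catchProbMin sstar plan ≠ ∞ :=
    ne_top_of_le_ne_top hgt (iInf_le _ g)
  have h1 : (q.lexp fun s => if s = g then x else 0) = M.catchProbMin sstar plan := by
    rw [PMF.lexp, tsum_eq_single g]
    · rw [if_pos rfl]
      exact ENNReal.mul_div_cancel hg hgt
    · intro s hs
      simp [hs]
  refine ENNReal.eq_sub_of_add_eq hmin ?_
  rw [← h1, ← PMF.lexp_add]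
  refine Eq.trans ?_ (q.lexp_const 1)
  congr 1
  funext s
  by_cases hs : s = g
  · simp [catchFail, hs, ← hx, tsub_add_cancel_of_le hx1]
  · simp [catchFail, hs]

open Classical in
/-- A bound for the expected number of rounds before the algorithm follows the recommended policy,
provided that this policy does not change. Here `B` bounds the duration of the catching
procedure started at `s^*`, and `K` the one from any state. -/
noncomputable def catchTime [Fintype S] [Fintype A] (M : MDP S A) (sstar : S) (plan : CatchPlan S A)
    (B K : ℝ≥0∞) (s : S) : Mode S → ℝ≥0∞
  | .follow => 0
  -- The values `∞`, here and for `k ≥ len`, belong to configurations that the algorithm never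
  -- enters; they make the drift inequality trivial there.
  | .home s₀ => if s = sstar then ∞ else M.expHit (plan.home s₀) s sstar + B
  | .chase k g =>
      if k < plan.len then ((plan.len - k : ℕ) : ℝ≥0∞)
        + K * M.catchFail sstar plan g (plan.len - k) s else ∞

/-- The indicator of the rounds in which the recommended policy is not followed. -/
noncomputable def Mode.idle : Mode S → ℝ≥0∞
  | .follow => 0
  | _ => 1

section CatchTime

variable [Fintype S] [Fintype A] (M : MDP S A) (d₁ : PMF S) (sstar : S) (plan : CatchPlan S A)
  {B K : ℝ≥0∞}

theorem idle_le_catchTime (s : S) (m : Mode S) : m.idle ≤ M.catchTime sstar plan B K s m := by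
  cases m with
  | follow => simp [Mode.idle]
  | home s₀ =>
    simp only [Mode.idle, catchTime]
    split_ifs with h
    · simp
    · exact (M.one_le_expHit _ h).trans le_self_add
  | chase k g =>
    simp only [Mode.idle, catchTime]
    split_ifs with h
    · refine le_trans ?_ le_self_add
      exact_mod_cast (by omega : 1 ≤ plan.len - k)
    · simp

theorem lexp_tryCatch_start (hlen : 0 < plan.len) (hpos : ∀ g, M.catchProb sstar plan g ≠ 0)
    (hB : plan.len + K * (1 - M.catchProbMin sstar plan) ≤ B) (π : S → A) (t : ℕ) :
    (M.tryCatch d₁ sstar plan π t sstar).lexp (M.catchTime sstar plan B K sstar) ≤ B := by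
  rw [tryCatch, if_pos rfl, PMF.lexp_map]
  refine PMF.lexp_le_const _ fun g => ?_
  simp only [catchTime, hlen, if_true, Nat.sub_zero]
  rwa [M.catchFail_start sstar plan g (hpos g)]

theorem lexp_tryCatch (hlen : 0 < plan.len) (hpos : ∀ g, M.catchProb sstar plan g ≠ 0)
    (hB : plan.len + K * (1 - M.catchProbMin sstar plan) ≤ B)
    (hBK : B ≤ K) (hK : ∀ s, s ≠ sstar → M.expHit (plan.home s) s sstar + B ≤ K)
    (π : S → A) (t : ℕ) (s : S) :
    (M.tryCatch d₁ sstar plan π t s).lexp (M.catchTime sstar plan B K s) ≤ K := by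
  by_cases hs : s = sstar
  · subst hs
    exact (M.lexp_tryCatch_start d₁ s plan hlen hpos hB π t).trans hBK
  · rw [tryCatch, if_neg hs, PMF.lexp_pure]
    simp only [catchTime, hs, if_false]
    exact hK s hs

-- The drift inequality: the potential falls in the mean by at least `1` in each idle round, and a
-- switch raises it by at most `K`.
open Classical in
theorem lexp_nextMode_add_idle (hlen : 0 < plan.len) (hpos : ∀ g, M.catchProb sstar plan g ≠ 0)
    (hB : plan.len + K * (1 - M.catchProbMin sstar plan) ≤ B)
    (hBK : B ≤ K) (hK : ∀ s, s ≠ sstar → M.expHit (plan.home s) s sstar + B ≤ K)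
    (π' π : S → A) (t : ℕ) (s : S) (m : Mode S) :
    ((actionLaw plan π' s m).lexp fun a => (M.P s a).lexp fun s' =>
        (M.nextMode d₁ sstar plan π' π t s' m).lexp (M.catchTime sstar plan B K s')) + m.idle
      ≤ M.catchTime sstar plan B K s m + K * (if π = π' then 0 else 1) := by
  by_cases hπ : π = π'
  swap
  -- At a switch the old potential pays for the idle round, and the extra `K` pays for the restart.
  · simp only [nextMode, hπ, if_false, mul_one]
    rw [add_comm]
    refine add_le_add (M.idle_le_catchTime sstar plan s m) ?_
    refine PMF.lexp_le_const _ fun a => PMF.lexp_le_const _ fun s' => ?_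
    exact M.lexp_tryCatch d₁ sstar plan hlen hpos hB hBK hK π t s'
  simp only [nextMode, hπ, if_true, mul_zero, add_zero]
  cases m with
  | follow =>
    simp [Mode.idle, PMF.lexp_pure, catchTime, PMF.lexp_const]
  | home s₀ =>
    by_cases hs : s = sstar
    · simp [catchTime, hs]
    simp only [catchTime, hs, if_false, actionLaw, Mode.idle]
    rw [M.expHit_eq _ hs, add_comm _ (1 : ℝ≥0∞), add_assoc]
    refine add_le_add le_rfl ?_
    rw [← PMF.lexp_const (plan.home s₀ s) B, ← PMF.lexp_add]
    refine PMF.lexp_mono _ fun a => ?_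
    rw [← PMF.lexp_const (M.P s a) B, ← PMF.lexp_add]
    refine PMF.lexp_mono _ fun s' => ?_
    by_cases hs' : s' = sstar
    · subst hs'
      simpa [expHit_self, PMF.lexp_const] using
        M.lexp_tryCatch_start d₁ s' plan hlen hpos hB π' t
    · simp [hs', PMF.lexp_pure, catchTime, PMF.lexp_const]
  | chase k g =>
    by_cases hk : k < plan.len
    swap
    · simp [catchTime, hk]
    obtain ⟨j, hj⟩ : ∃ j, plan.len - k = j + 1 := ⟨plan.len - (k + 1), by omega⟩
    have hj' : plan.len - (j + 1) = k := by omega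
    have hrhs : M.catchTime sstar plan B K s (.chase k g) =
        ((plan.chase g k s).lexp fun a => (M.P s a).lexp fun s' =>
          (j : ℝ≥0∞) + K * M.catchFail sstar plan g j s') + 1 := by
      simp only [catchTime, hk, if_true, hj, catchFail, hj', PMF.lexp_add, PMF.lexp_const,
        PMF.lexp_const_mul]
      push_cast
      ring
    rw [hrhs]
    simp only [Mode.idle, actionLaw]
    refine add_le_add ?_ le_rfl
    refine PMF.lexp_mono _ fun a => PMF.lexp_mono _ fun s' => ?_
    by_cases hk1 : k + 1 < plan.len
    · simp only [hk1, if_true, PMF.lexp_pure, catchTime]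
      rw [show plan.len - (k + 1) = j by omega]
    -- The chase makes its last step: `catchFail` at `0` is the probability that the loop continues,
    -- which then costs at most `K`.
    have hj0 : j = 0 := by omega
    subst hj0
    simp only [hk1, if_false, catchFail, Nat.cast_zero, zero_add]
    have htry := M.lexp_tryCatch d₁ sstar plan hlen hpos hB hBK hK π' t s'
    split_ifs with hs'
    · rw [PMF.lexp_bind, lexp_coin]
      simp only [if_true, PMF.lexp_pure, Bool.false_eq_true, if_false, catchTime, mul_zero,
        zero_add]
      rw [mul_comm K]
      exact mul_le_mul_right htry _
    · simpa using htry

-- The drift inequality telescopes, starting from potential `0` since the algorithm begins by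
-- following. The count on the right includes a switch at time `T`, where the final potential is
-- evaluated.
open Classical in
theorem sum_idle_le (hlen : 0 < plan.len) (hpos : ∀ g, M.catchProb sstar plan g ≠ 0)
    (hB : plan.len + K * (1 - M.catchProbMin sstar plan) ≤ B)
    (hBK : B ≤ K) (hK : ∀ s, s ≠ sstar → M.expHit (plan.home s) s sstar + B ≤ K)
    (seq : ℕ → S → A) (T : ℕ) :
    ∑ t ∈ Finset.range T, (M.configLaw d₁ sstar plan seq t).lexp (fun c => c.2.idle)
      ≤ K * ∑ t ∈ Finset.range T, if seq (t + 1) = seq t then 0 else 1 := by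
  suffices h : (M.configLaw d₁ sstar plan seq T).lexp
        (fun c => M.catchTime sstar plan B K c.1 c.2)
      + ∑ t ∈ Finset.range T, (M.configLaw d₁ sstar plan seq t).lexp (fun c => c.2.idle)
      ≤ K * ∑ t ∈ Finset.range T, if seq (t + 1) = seq t then 0 else 1 from
    le_add_self.trans h
  induction T with
  | zero => simp [configLaw, PMF.lexp_map, catchTime, PMF.lexp_const]
  | succ T ih =>
    rw [Finset.sum_range_succ, Finset.sum_range_succ, mul_add]
    refine le_trans ?_ (add_le_add ih le_rfl)
    rw [add_comm (Finset.sum _ _), ← add_assoc, add_right_comm _ (Finset.sum _ _)]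
    refine add_le_add ?_ le_rfl
    rw [configLaw, ← PMF.lexp_const (M.configLaw d₁ sstar plan seq T) (K * ite _ _ _),
      PMF.lexp_bind, ← PMF.lexp_add, ← PMF.lexp_add]
    refine PMF.lexp_mono _ fun c => ?_
    simp only [PMF.lexp_bind, PMF.lexp_map]
    exact M.lexp_nextMode_add_idle d₁ sstar plan hlen hpos hB hBK hK _ _ _ _ _

end CatchTime

end MDP

namespace MDP

variable {S A : Type*}

/-! ### The law of the state while the recommended policy is followed -/

theorem stateLaw_succ_apply (M : MDP S A) (μ : PMF S) (π : ℕ → S → PMF A) (n : ℕ) (s' : S) :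
    M.stateLaw μ π (n + 1) s' =
      ∑' s, M.stateLaw μ π n s * (π n s).lexp fun a => M.P s a s' := rfl

open Classical in
theorem lexp_ite_mode_eq (p : PMF (S × Mode S)) (m : Mode S) (F : S → ℝ≥0∞) :
    (p.lexp fun c => if c.2 = m then F c.1 else 0) = ∑' s, p (s, m) * F s := by
  rw [PMF.lexp, ENNReal.tsum_prod']
  refine tsum_congr fun s => ?_
  rw [tsum_eq_single m]
  · simp
  · intro m' hm'
    simp [hm']

section

variable (M : MDP S A) (d₁ : PMF S) (sstar : S) (plan : CatchPlan S A)

theorem configLaw_succ_apply (seq : ℕ → S → A) (t : ℕ) (s' : S) (m' : Mode S) :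
    M.configLaw d₁ sstar plan seq (t + 1) (s', m') =
      (M.configLaw d₁ sstar plan seq t).lexp fun c =>
        ((actionLaw plan (seq t) c.1 c.2).lexp fun a => M.P c.1 a s') *
          M.nextMode d₁ sstar plan (seq t) (seq (t + 1)) (t + 1) s' c.2 m' := by
  classical
  rw [configLaw, PMF.bind_apply_eq_lexp]
  congr 1
  funext c
  rw [PMF.bind_apply_eq_lexp, mul_comm, ← PMF.lexp_const_mul]
  congr 1
  funext a
  rw [PMF.bind_apply_eq_lexp, PMF.lexp, tsum_eq_single s']
  · rw [PMF.map_apply_eq_lexp, mul_comm]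
    congr 1
    rw [PMF.lexp, tsum_eq_single m']
    · simp
    · intro m hm
      simp [hm]
  · intro s hs
    rw [PMF.map_apply_eq_lexp]
    simp [hs, PMF.lexp]

theorem tryCatch_follow (π : S → A) (t : ℕ) (s : S) :
    M.tryCatch d₁ sstar plan π t s .follow = 0 := by
  classical
  unfold tryCatch
  split_ifs
  · simp
  · simp [PMF.pure_apply]

theorem tryCatch_chase_succ (π : S → A) (t : ℕ) (s : S) (k : ℕ) (g : S) :
    M.tryCatch d₁ sstar plan π t s (.chase (k + 1) g) = 0 := by
  classical
  unfold tryCatch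
  split_ifs
  · simp
  · simp [PMF.pure_apply]

open Classical in
theorem tryCatch_chase_zero (π : S → A) (t : ℕ) (s : S) (g : S) :
    M.tryCatch d₁ sstar plan π t s (.chase 0 g) =
      if s = sstar then M.detLaw d₁ π (t + plan.len) g else 0 := by
  unfold tryCatch
  split_ifs
  · rw [PMF.map_apply_eq_lexp, PMF.lexp, tsum_eq_single g]
    · simp
    · intro b hb
      simp [hb]
  · simp [PMF.pure_apply]

theorem coin_bind_apply {α : Type*} (p : ℝ≥0∞) (hp : p ≤ 1) (f : Bool → PMF α) (x : α) :
    (coin p hp).bind f x = p * f true x + (1 - p) * f false x := by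
  rw [PMF.bind_apply_eq_lexp, lexp_coin]

-- A chase can end in following only if its target is the present state. The sum over `k` encodes
-- that `m` is a chase of `s`; at most one of its terms is nonzero.
open Classical in
theorem nextMode_follow (π' π : S → A) (t : ℕ) (s : S) (m : Mode S) :
    M.nextMode d₁ sstar plan π' π t s m .follow =
      if π = π' then (if m = .follow then 1 else 0) + ∑' k, (if m = .chase k s then
        (if k + 1 < plan.len then 0
          else M.catchProbMin sstar plan / M.catchProb sstar plan s) else 0)
      else 0 := by
  unfold nextMode
  by_cases hπ : π = π'
  swap
  · simp only [hπ, if_false]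
    exact M.tryCatch_follow d₁ sstar plan π t s
  simp only [hπ, if_true]
  cases m with
  | follow => simp
  | home s₀ =>
    dsimp only
    split_ifs <;> simp_all [tryCatch_follow, PMF.pure_apply]
  | chase k g =>
    dsimp only
    rw [if_neg (show ¬ (Mode.chase k g : Mode S) = .follow by simp), zero_add]
    by_cases hg : s = g
    · subst hg
      rw [tsum_eq_single k (by
        intro k' hk'
        simp [Ne.symm hk']), if_pos rfl]
      by_cases hk : k + 1 < plan.len
      · simp [hk, PMF.pure_apply]
      · simp [-PMF.bind_apply, hk, tryCatch_follow, PMF.pure_apply, coin_bind_apply]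
    · by_cases hk : k + 1 < plan.len
      · simp [hk, PMF.pure_apply, Ne.symm hg]
      · simp [hk, hg, tryCatch_follow, Ne.symm hg]

open Classical in
theorem nextMode_chase_succ (π' π : S → A) (t : ℕ) (s : S) (m : Mode S) (k : ℕ) (g : S) :
    M.nextMode d₁ sstar plan π' π t s m (.chase (k + 1) g) =
      if π = π' ∧ k + 1 < plan.len then (if m = .chase k g then 1 else 0) else 0 := by
  unfold nextMode
  by_cases hπ : π = π'
  swap
  · simp [hπ, tryCatch_chase_succ]
  simp only [hπ, if_true, true_and]
  cases m with
  | follow => simp [PMF.pure_apply]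
  | home s₀ =>
    dsimp only
    split_ifs <;> simp [tryCatch_chase_succ, PMF.pure_apply] <;> simp_all
  | chase k' g' =>
    dsimp only
    by_cases hk' : k' + 1 < plan.len
    · rw [if_pos hk', PMF.pure_apply]
      by_cases hkk : k' = k ∧ g' = g
      · obtain ⟨rfl, rfl⟩ := hkk
        simp [hk']
      · have h1 : ¬ (Mode.chase (k + 1) g : Mode S) = .chase (k' + 1) g' := by
          intro h
          injection h with h1 h2
          exact hkk ⟨by omega, h2.symm⟩
        have h2 : ¬ (Mode.chase k' g' : Mode S) = .chase k g := by
          intro h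
          injection h with h1 h2
          exact hkk ⟨h1, h2⟩
        simp [h1, h2]
    · have hrhs : (if k + 1 < plan.len then
          (if (Mode.chase k' g' : Mode S) = .chase k g then (1 : ℝ≥0∞) else 0) else 0) = 0 := by
        split_ifs with h1 h2
        · injection h2 with h3 h4
          omega
        · rfl
        · rfl
      rw [hrhs]
      split_ifs
      · simp [tryCatch_chase_succ, PMF.pure_apply]
      · simp [tryCatch_chase_succ]

-- A fresh target is drawn independently of the previous mode, so the law of the target splits off.
-- The weight `w` may depend on everything except `g`; this is what the product form of the joint
-- law rests on.
open Classical in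
theorem exists_nextMode_chase_zero (π' π : S → A) (t : ℕ) (s : S) (m : Mode S) :
    ∃ w : ℝ≥0∞, ∀ g, M.nextMode d₁ sstar plan π' π t s m (.chase 0 g) =
      w * if s = sstar then M.detLaw d₁ π (t + plan.len) g else 0 := by
  unfold nextMode
  simp only [← tryCatch_chase_zero]
  by_cases hπ : π = π'
  swap
  · simp only [hπ, if_false]
    exact ⟨1, fun g => (one_mul _).symm⟩
  simp only [hπ, if_true]
  cases m with
  | follow => exact ⟨0, fun g => by simp [PMF.pure_apply]⟩
  | home s₀ =>
    by_cases hs : s = sstar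
    · simp only [hs, if_true]
      exact ⟨1, fun g => (one_mul _).symm⟩
    · simp only [hs, if_false]
      exact ⟨0, fun g => by simp [PMF.pure_apply]⟩
  | chase k g' =>
    by_cases hk : k + 1 < plan.len
    · simp only [hk, if_true]
      exact ⟨0, fun g => by simp [PMF.pure_apply]⟩
    by_cases hs : s = g'
    · simp only [hk, if_false, hs, if_true, coin_bind_apply]
      exact ⟨1 - M.catchProbMin sstar plan / M.catchProb sstar plan g',
        fun g => by simp [PMF.pure_apply]⟩
    · simp only [hk, if_false, hs]
      exact ⟨1, fun g => (one_mul _).symm⟩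

/-! ### Product form of the joint law of state and mode -/

theorem configLaw_zero_apply (seq : ℕ → S → A) (s : S) :
    M.configLaw d₁ sstar plan seq 0 (s, .follow) = d₁ s := by
  classical
  rw [configLaw, PMF.map_apply_eq_lexp, PMF.lexp, tsum_eq_single s]
  · simp
  · intro b hb
    simp [hb]

theorem configLaw_zero_chase (seq : ℕ → S → A) (s : S) (k : ℕ) (g : S) :
    M.configLaw d₁ sstar plan seq 0 (s, .chase k g) = 0 := by
  classical
  rw [configLaw, PMF.map_apply_eq_lexp]
  simp [PMF.lexp]

theorem configLaw_chase_eq_zero (hlen : 0 < plan.len) (seq : ℕ → S → A) (t : ℕ) (s : S) {k : ℕ}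
    (hk : plan.len ≤ k) (g : S) : M.configLaw d₁ sstar plan seq t (s, .chase k g) = 0 := by
  classical
  cases t with
  | zero => exact M.configLaw_zero_chase d₁ sstar plan seq s k g
  | succ t =>
    obtain ⟨j, rfl⟩ : ∃ j, k = j + 1 := ⟨k - 1, by omega⟩
    rw [configLaw_succ_apply]
    simp [nextMode_chase_succ, show ¬ j + 1 < plan.len by omega, PMF.lexp]

/-- During a chase, the target has the law it had when it was drawn, and given the target, the
state evolves as prescribed by the chasing policy. -/
theorem exists_configLaw_chase (seq : ℕ → S → A) (t k : ℕ)
    (hk : k < plan.len) :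
    ∃ r : ℝ≥0∞, ∀ g s, M.configLaw d₁ sstar plan seq t (s, .chase k g) =
      r * M.detLaw d₁ (seq t) (t + plan.len - k) g *
        M.stateLaw (PMF.pure sstar) (plan.chase g) k s := by
  classical
  induction t generalizing k with
  | zero => exact ⟨0, fun g s => by simp [configLaw_zero_chase]⟩
  | succ t ih =>
    cases k with
    | zero =>
      choose w hw using fun c : S × Mode S =>
        M.exists_nextMode_chase_zero d₁ sstar plan (seq t) (seq (t + 1)) (t + 1) sstar c.2
      refine ⟨(M.configLaw d₁ sstar plan seq t).lexp fun c =>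
        ((actionLaw plan (seq t) c.1 c.2).lexp fun a => M.P c.1 a sstar) * w c, fun g s => ?_⟩
      rw [configLaw_succ_apply]
      by_cases hs : s = sstar
      · subst hs
        simp only [hw, if_true, stateLaw, PMF.pure_apply, mul_one, Nat.sub_zero]
        rw [mul_comm _ (M.detLaw _ _ _ _), ← PMF.lexp_const_mul]
        congr 1
        funext c
        ring
      · have h0 : ∀ m, M.nextMode d₁ sstar plan (seq t) (seq (t + 1)) (t + 1) s m
            (.chase 0 g) = 0 := by
          intro m
          obtain ⟨w', hw'⟩ :=
            M.exists_nextMode_chase_zero d₁ sstar plan (seq t) (seq (t + 1)) (t + 1) s m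
          rw [hw' g, if_neg hs, mul_zero]
        simp [h0, PMF.lexp, stateLaw, PMF.pure_apply, hs]
    | succ k =>
      by_cases hπ : seq (t + 1) = seq t
      · obtain ⟨r, hr⟩ := ih k (by omega)
        refine ⟨r, fun g s => ?_⟩
        rw [configLaw_succ_apply]
        simp only [nextMode_chase_succ, hπ, true_and, hk, if_true, mul_ite, mul_one, mul_zero]
        rw [show (fun c : S × Mode S => if c.2 = .chase k g then
            ((actionLaw plan (seq t) c.1 c.2).lexp fun a => M.P c.1 a s) else 0) =
            fun c => if c.2 = .chase k g then
              ((plan.chase g k c.1).lexp fun a => M.P c.1 a s) else 0 from by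
          funext c
          split_ifs with h
          · simp [h, actionLaw]
          · rfl]
        rw [lexp_ite_mode_eq _ _ fun s₀ => (plan.chase g k s₀).lexp fun a => M.P s₀ a s,
          stateLaw_succ_apply, ← ENNReal.tsum_mul_left]
        refine tsum_congr fun s₀ => ?_
        -- The arrival time of the chase stays fixed, since the time and the step count grow
        -- together.
        rw [hr, show t + 1 + plan.len - (k + 1) = t + plan.len - k by omega, mul_assoc]
      · refine ⟨0, fun g s => ?_⟩
        rw [configLaw_succ_apply]
        simp [nextMode_chase_succ, hπ, PMF.lexp]

/-- While the recommended policy is followed, the state has the law that it would have if this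
policy had been followed from the start. -/
theorem exists_configLaw_follow (hlen : 0 < plan.len)
    (hpos : ∀ g, M.catchProb sstar plan g ≠ 0) (seq : ℕ → S → A) (t : ℕ) :
    ∃ q : ℝ≥0∞, ∀ s, M.configLaw d₁ sstar plan seq t (s, .follow) =
      q * M.detLaw d₁ (seq t) t s := by
  classical
  induction t with
  | zero => exact ⟨1, fun s => by simp [configLaw_zero_apply, detLaw, stateLaw]⟩
  | succ t ih =>
    by_cases hπ : seq (t + 1) = seq t
    swap
    · refine ⟨0, fun s => ?_⟩
      rw [configLaw_succ_apply]
      simp [nextMode_follow, hπ, PMF.lexp]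
    obtain ⟨q, hq⟩ := ih
    obtain ⟨r, hr⟩ := M.exists_configLaw_chase d₁ sstar plan seq t (plan.len - 1) (by omega)
    -- The mass `q` keeps following. The chases arriving now add `r * d(s) * p_s * (p^* / p_s) = r *
    -- p^* * d(s)`, with `d` the law `detLaw` at time `t + 1`, again a multiple of that law.
    refine ⟨q + r * M.catchProbMin sstar plan, fun s => ?_⟩
    set x := M.catchProbMin sstar plan / M.catchProb sstar plan s with hx
    have hfun : (fun c : S × Mode S =>
        ((actionLaw plan (seq t) c.1 c.2).lexp fun a => M.P c.1 a s) *
          M.nextMode d₁ sstar plan (seq t) (seq (t + 1)) (t + 1) s c.2 .follow) =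
        fun c => (if c.2 = .follow then
            ((PMF.pure (seq t c.1)).lexp fun a => M.P c.1 a s) else 0) +
          ∑' k, if c.2 = .chase k s then
            ((plan.chase s k c.1).lexp fun a => M.P c.1 a s) *
              (if k + 1 < plan.len then 0 else x) else 0 := by
      funext c
      rw [nextMode_follow, if_pos hπ, mul_add, ← ENNReal.tsum_mul_left]
      congr 1
      · split_ifs with h
        · simp [h, actionLaw]
        · simp
      · refine tsum_congr fun k => ?_
        split_ifs with h h'
        · simp
        · simp [h, actionLaw, hx]
        · simp
    rw [configLaw_succ_apply, hfun, PMF.lexp_add, PMF.lexp_tsum, add_mul,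
      lexp_ite_mode_eq _ _ fun s₀ => (PMF.pure (seq t s₀)).lexp fun a => M.P s₀ a s,
      tsum_eq_single (plan.len - 1)]
    · congr 1
      · rw [hπ, detLaw, stateLaw_succ_apply, ← ENNReal.tsum_mul_left]
        refine tsum_congr fun s₀ => ?_
        rw [hq, mul_assoc]
        rfl
      · rw [lexp_ite_mode_eq _ _ fun s₀ =>
          ((plan.chase s (plan.len - 1) s₀).lexp fun a => M.P s₀ a s) *
              (if plan.len - 1 + 1 < plan.len then 0 else x), if_neg (by omega)]
        have hsum : ∑' s₀, M.configLaw d₁ sstar plan seq t (s₀, .chase (plan.len - 1) s) *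
            (((plan.chase s (plan.len - 1) s₀).lexp fun a => M.P s₀ a s) * x) =
            r * M.detLaw d₁ (seq t) (t + 1) s * (M.catchProb sstar plan s * x) := by
          have hp : M.catchProb sstar plan s = ∑' s₀, M.stateLaw (PMF.pure sstar) (plan.chase s)
              (plan.len - 1) s₀ * (plan.chase s (plan.len - 1) s₀).lexp fun a => M.P s₀ a s := by
            rw [← stateLaw_succ_apply, catchProb, Nat.sub_add_cancel hlen]
          rw [hp, ← ENNReal.tsum_mul_right, ← ENNReal.tsum_mul_left]
          refine tsum_congr fun s₀ => ?_
          rw [hr, show t + plan.len - (plan.len - 1) = t + 1 by omega]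
          ring
        rw [hsum, hx, ENNReal.mul_div_cancel (hpos s) (PMF.apply_ne_top _ _), hπ]
        ring
    -- Only chases at `k = len - 1` can end now: shorter ones go on, and longer ones have
    -- probability `0`.
    · intro k hk
      rw [lexp_ite_mode_eq _ _ fun s₀ => ((plan.chase s k s₀).lexp fun a => M.P s₀ a s) *
              (if k + 1 < plan.len then 0 else x)]
      rw [ENNReal.tsum_eq_zero]
      intro s₀
      by_cases hk' : k + 1 < plan.len
      · simp [hk']
      · rw [M.configLaw_chase_eq_zero d₁ sstar plan hlen seq t s₀ (by omega) s, zero_mul]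

/-! ### The loss of the algorithm for given recommendations -/

-- The event is split by mode. The following part is `q` times the law under the recommended policy,
-- with `q ≤ 1` because the total mass is `1`; the rest is charged to idle rounds.
open Classical in
theorem stateActionLaw_le (hlen : 0 < plan.len)
    (hpos : ∀ g, M.catchProb sstar plan g ≠ 0) (seq : ℕ → S → A) (t : ℕ) (s : S) (a : A) :
    M.stateActionLaw d₁ sstar plan seq t (s, a) ≤
      (if a = seq t s then M.detLaw d₁ (seq t) t s else 0) +
        (M.configLaw d₁ sstar plan seq t).lexp fun c =>
          if c.1 = s then c.2.idle * actionLaw plan (seq t) c.1 c.2 a else 0 := by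
  obtain ⟨q, hq⟩ := M.exists_configLaw_follow d₁ sstar plan hlen hpos seq t
  have hq1 : q ≤ 1 := by
    calc q = ∑' s, q * M.detLaw d₁ (seq t) t s := by
          rw [ENNReal.tsum_mul_left, PMF.tsum_coe, mul_one]
      _ = (M.configLaw d₁ sstar plan seq t).lexp fun c => if c.2 = .follow then 1 else 0 := by
          rw [lexp_ite_mode_eq _ _ fun _ => 1]
          simp [hq]
      _ ≤ 1 := PMF.lexp_le_const _ fun c => by split_ifs <;> simp
  have hfol : (M.configLaw d₁ sstar plan seq t).lexp (fun c => if c.2 = .follow then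
      (if c.1 = s ∧ a = seq t s then 1 else 0) else 0) ≤
      if a = seq t s then M.detLaw d₁ (seq t) t s else 0 := by
    rw [lexp_ite_mode_eq _ _ fun s₀ => if s₀ = s ∧ a = seq t s then 1 else 0,
      tsum_eq_single s]
    · split_ifs with h1 h2 h2
      · rw [hq, mul_one]
        exact mul_le_of_le_one_left zero_le hq1
      · exact absurd h1.2 h2
      · simp
      · simp
    · intro s₀ hs
      simp [hs]
  refine le_trans ?_ (add_le_add hfol le_rfl)
  rw [← PMF.lexp_add, stateActionLaw, PMF.bind_apply_eq_lexp]
  refine PMF.lexp_mono _ fun c => ?_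
  rw [PMF.map_apply_eq_lexp]
  by_cases hs : c.1 = s
  · refine (le_of_eq (?_ : _ = actionLaw plan (seq t) c.1 c.2 a)).trans ?_
    · rw [PMF.lexp, tsum_eq_single a]
      · simp [hs]
      · intro b hb
        simp [hb]
    rw [if_pos hs]
    obtain ⟨s₁, m⟩ := c
    obtain rfl : s₁ = s := hs
    cases m with
    | follow => simp [Mode.idle, actionLaw, PMF.pure_apply]
    | home s₀ => simp [Mode.idle]
    | chase k g => simp [Mode.idle]
  · simp [hs, PMF.lexp]

theorem sum_lexp_idle [Fintype S] [Fintype A] (seq : ℕ → S → A) (t : ℕ) [DecidableEq S] :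
    ∑ x : S × A, (M.configLaw d₁ sstar plan seq t).lexp (fun c =>
        if c.1 = x.1 then c.2.idle * actionLaw plan (seq t) c.1 c.2 x.2 else 0) =
      (M.configLaw d₁ sstar plan seq t).lexp fun c => c.2.idle := by
  rw [← tsum_fintype (L := .unconditional _), ← PMF.lexp_tsum]
  congr 1
  funext c
  rw [ENNReal.tsum_prod', tsum_eq_single c.1]
  · simp only [if_true, ENNReal.tsum_mul_left, PMF.tsum_coe, mul_one]
  · intro s hs
    simp [Ne.symm hs]

theorem lexp_idle_le_one (p : PMF (S × Mode S)) : p.lexp (fun c => c.2.idle) ≤ 1 :=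
  PMF.lexp_le_const _ fun c => by
    rcases c with ⟨s, _ | _ | _⟩ <;> simp [Mode.idle]

/-- As losses are at most `1`, the idle part costs no more than its probability. -/
theorem sum_stateActionLaw_le [Fintype S] [Fintype A] (hlen : 0 < plan.len)
    (hpos : ∀ g, M.catchProb sstar plan g ≠ 0) (seq : ℕ → S → A) (t : ℕ) {ℓ : ℕ → S → A → ℝ}
    (hℓ : ∀ s a, ℓ t s a ∈ Set.Icc (0 : ℝ) 1) :
    ∑ x : S × A, (M.stateActionLaw d₁ sstar plan seq t x).toReal * ℓ t x.1 x.2 ≤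
      M.hatLoss d₁ ℓ t (seq t) +
        ((M.configLaw d₁ sstar plan seq t).lexp fun c => c.2.idle).toReal := by
  classical
  have hsum := M.sum_lexp_idle d₁ sstar plan seq t
  set R : S × A → ℝ≥0∞ := fun x => (M.configLaw d₁ sstar plan seq t).lexp fun c =>
    if c.1 = x.1 then c.2.idle * actionLaw plan (seq t) c.1 c.2 x.2 else 0 with hR
  have hRtop : ∀ x, R x ≠ ∞ := fun x => by
    refine ne_top_of_le_ne_top ENNReal.one_ne_top ?_
    refine le_trans ?_ (hsum.trans_le (lexp_idle_le_one _))
    exact Finset.single_le_sum (f := R) (fun _ _ => zero_le) (Finset.mem_univ x)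
  rw [← hsum, ENNReal.toReal_sum fun x _ => hRtop x]
  have hhat : M.hatLoss d₁ ℓ t (seq t) = ∑ x : S × A,
      (if x.2 = seq t x.1 then (M.detLaw d₁ (seq t) t x.1).toReal * ℓ t x.1 x.2 else 0) := by
    rw [Fintype.sum_prod_type, hatLoss]
    refine Finset.sum_congr rfl fun s _ => ?_
    simp
  rw [hhat, ← Finset.sum_add_distrib]
  refine Finset.sum_le_sum fun x _ => ?_
  have h := M.stateActionLaw_le d₁ sstar plan hlen hpos seq t x.1 x.2
  have h' := ENNReal.toReal_mono (ENNReal.add_ne_top.2 ⟨by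
    split_ifs
    · exact PMF.apply_ne_top _ _
    · simp, hRtop x⟩) h
  rw [ENNReal.toReal_add (by
    split_ifs
    · exact PMF.apply_ne_top _ _
    · simp) (hRtop x)] at h'
  obtain ⟨h0, h1⟩ := hℓ x.1 x.2
  refine (mul_le_mul_of_nonneg_right h' h0).trans ?_
  rw [add_mul]
  refine add_le_add ?_ (mul_le_of_le_one_right ENNReal.toReal_nonneg h1)
  split_ifs <;> simp

end

end MDP

/-! ### Exponential perturbations -/

theorem lintegral_expMeasure {r : ℝ} {f : ℝ → ℝ≥0∞} (hf : Measurable f) :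
    ∫⁻ y, f y ∂(expMeasure r) = ∫⁻ y, exponentialPDF r y * f y := by
  rw [expMeasure, gammaMeasure, lintegral_withDensity_eq_lintegral_mul _ _ hf]
  · rfl
  · exact (measurable_exponentialPDFReal r).ennreal_ofReal

/-- There is equality for `y ≥ x`; for `y < x` the left side vanishes. -/
theorem exponentialPDF_sub_le {r x : ℝ} (hx : 0 ≤ x) (y : ℝ) :
    exponentialPDF r (y - x) ≤ ENNReal.ofReal (Real.exp (r * x)) * exponentialPDF r y := by
  rcases lt_or_ge (y - x) 0 with h | h
  · simp [exponentialPDF_of_neg h]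
  · rw [exponentialPDF_of_nonneg h, exponentialPDF_of_nonneg (by linarith),
      ← ENNReal.ofReal_mul (Real.exp_pos _).le]
    refine le_of_eq ?_
    congr 1
    rw [mul_left_comm, ← Real.exp_add]
    ring_nf

theorem lintegral_expMeasure_add_le {r x : ℝ} (hx : 0 ≤ x) {f : ℝ → ℝ≥0∞} (hf : Measurable f) :
    ∫⁻ y, f (y + x) ∂(expMeasure r) ≤
      ENNReal.ofReal (Real.exp (r * x)) * ∫⁻ y, f y ∂(expMeasure r) := by
  rw [lintegral_expMeasure hf, lintegral_expMeasure (f := fun y => f (y + x)) (by fun_prop),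
    ← lintegral_const_mul' _ _ ENNReal.ofReal_ne_top]
  have h := lintegral_add_right_eq_self (μ := (volume : Measure ℝ))
    (fun y => exponentialPDF r (y - x) * f y) x
  simp only [add_sub_cancel_right] at h
  rw [h]
  refine lintegral_mono fun y => ?_
  rw [← mul_assoc]
  exact mul_le_mul_left (exponentialPDF_sub_le hx y) _

theorem ae_nonneg_expMeasure {r : ℝ} : ∀ᵐ y ∂(expMeasure r), 0 ≤ y := by
  have h : expMeasure r (Set.Iio 0) = 0 := by
    rw [← lintegral_indicator_one measurableSet_Iio,
      lintegral_expMeasure (measurable_one.indicator measurableSet_Iio), lintegral_eq_zero_iff']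
    · refine Filter.Eventually.of_forall fun y => ?_
      by_cases hy : y < 0
      · simp [exponentialPDF_of_neg hy]
      · simp [hy]
    · exact ((measurable_exponentialPDFReal r).ennreal_ofReal.mul
        (measurable_one.indicator measurableSet_Iio)).aemeasurable
  rw [ae_iff]
  convert h using 2
  ext y
  simp

/-- Times the density, the integrand is twice the exponential density of parameter `r / 2`. -/
theorem lintegral_exp_half_expMeasure {r : ℝ} (hr : 0 < r) :
    ∫⁻ y, ENNReal.ofReal (Real.exp (r * y / 2)) ∂(expMeasure r) = 2 := by
  rw [lintegral_expMeasure (by fun_prop)]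
  have h : ∀ y, exponentialPDF r y * ENNReal.ofReal (Real.exp (r * y / 2)) =
      2 * exponentialPDF (r / 2) y := fun y => by
    rcases lt_or_ge y 0 with hy | hy
    · simp [exponentialPDF_of_neg hy]
    · rw [exponentialPDF_of_nonneg hy, exponentialPDF_of_nonneg hy,
        ← ENNReal.ofReal_mul (by positivity), ← ENNReal.ofReal_ofNat 2,
        ← ENNReal.ofReal_mul (by norm_num), mul_assoc, ← Real.exp_add]
      congr 1
      rw [← mul_assoc]
      congr 1
      · ring
      · ring_nf
  simp only [h]
  rw [lintegral_const_mul' _ _ (by simp), lintegral_exponentialPDF_eq_one (by positivity), mul_one]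

theorem integrable_exp_half_expMeasure {r : ℝ} (hr : 0 < r) :
    Integrable (fun y => Real.exp (r * y / 2)) (expMeasure r) := by
  refine ⟨by fun_prop, ?_⟩
  rw [hasFiniteIntegral_iff_ofReal (Filter.Eventually.of_forall fun _ => (Real.exp_pos _).le),
    lintegral_exp_half_expMeasure hr]
  simp

theorem integral_exp_half_expMeasure {r : ℝ} (hr : 0 < r) :
    ∫ y, Real.exp (r * y / 2) ∂(expMeasure r) = 2 := by
  rw [integral_eq_lintegral_of_nonneg_ae (Filter.Eventually.of_forall fun _ => (Real.exp_pos _).le)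
    (by fun_prop), lintegral_exp_half_expMeasure hr]
  simp

/-- Adding `x` to one of the perturbations increases probabilities by a factor of at most
`exp (r x)`. -/
theorem pi_expMeasure_le_of_update_add {E : Type*} [Fintype E] [DecidableEq E] {r x : ℝ}
    (hr : 0 < r) (hx : 0 ≤ x) (i : E) {B B' : Set (E → ℝ)} (hB : MeasurableSet B)
    (hB' : MeasurableSet B') (h : ∀ ε ∈ B, Function.update ε i (ε i + x) ∈ B') :
    Measure.pi (fun _ : E => expMeasure r) B ≤
      ENNReal.ofReal (Real.exp (r * x)) * Measure.pi (fun _ : E => expMeasure r) B' := by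
  have _ : IsProbabilityMeasure (expMeasure r) := isProbabilityMeasure_expMeasure hr
  -- By Tonelli, coordinate `i` is integrated first with the others frozen, so that the
  -- one-dimensional shift bound applies.
  have key : ∀ f : (E → ℝ) → ℝ≥0∞, Measurable f →
      ∫⁻ ε, f ε ∂(Measure.pi fun _ : E => expMeasure r) =
        (∫⋯∫⁻_Finset.univ.erase i, (fun ε => ∫⁻ y, f (Function.update ε i y) ∂(expMeasure r))
          ∂fun _ : E => expMeasure r) 0 := fun f hf => by
    rw [lintegral_eq_lmarginal_univ (0 : E → ℝ), lmarginal_erase' _ hf (Finset.mem_univ i)]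
  have hBi : Measurable (B.indicator (1 : (E → ℝ) → ℝ≥0∞)) := measurable_one.indicator hB
  have hBi' : Measurable (B'.indicator (1 : (E → ℝ) → ℝ≥0∞)) := measurable_one.indicator hB'
  rw [← lintegral_indicator_one hB, ← lintegral_indicator_one hB',
    ← lintegral_const_mul' _ _ ENNReal.ofReal_ne_top, key _ hBi, key _ (hBi'.const_mul _)]
  refine lmarginal_mono (fun ε => ?_) 0
  dsimp only
  rw [lintegral_const_mul' _ _ ENNReal.ofReal_ne_top]
  refine le_trans (lintegral_mono fun y => ?_)
    (lintegral_expMeasure_add_le hx (hBi'.comp (measurable_update ε)))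
  dsimp only [Function.comp]
  by_cases hy : Function.update ε i y ∈ B
  · have h' := h _ hy
    rw [Function.update_idem, Function.update_self] at h'
    simp [hy, h']
  · simp [hy]

namespace MDP

variable {S A : Type*}

/-! ### Follow the perturbed leader -/

theorem argmin_le {E : Type*} [Fintype E] [Nonempty E] (f : E → ℝ) (e : E) :
    f (argmin f) ≤ f e := by
  have h := (argminSet_nonempty f).choose_spec
  simp only [argminSet, Finset.mem_filter, Finset.mem_univ, true_and] at h
  exact h e

theorem argmin_eq_of_lt {E : Type*} [Fintype E] [Nonempty E] (f : E → ℝ) {e : E}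
    (h : ∀ e', e' ≠ e → f e < f e') : argmin f = e := by
  by_contra hne
  exact absurd (argmin_le f e) (not_le.2 (h _ hne))

open Classical in
theorem isProbabilityMeasure_fplNoise [Fintype S] [Fintype A] {r : ℝ} (hr : 0 < r) :
    IsProbabilityMeasure (fplNoise S A r) := by
  have _ : IsProbabilityMeasure (expMeasure r) := isProbabilityMeasure_expMeasure hr
  unfold fplNoise
  infer_instance

open Classical in
theorem ae_nonneg_fplNoise [Fintype S] [Fintype A] {r : ℝ} (hr : 0 < r) :
    ∀ᵐ ε ∂(fplNoise S A r), ∀ π, 0 ≤ ε π := by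
  have _ : IsProbabilityMeasure (expMeasure r) := isProbabilityMeasure_expMeasure hr
  rw [ae_all_iff]
  intro π
  exact (measurePreserving_eval (fun _ : S → A => expMeasure r) π).quasiMeasurePreserving.ae
    ae_nonneg_expMeasure

theorem card_policies [Fintype S] [Fintype A] [DecidableEq S] :
    Real.log (Fintype.card (S → A)) = logPolicies S A := by
  rw [logPolicies, Fintype.card_fun, Nat.cast_pow, Real.log_pow]

section

variable [Fintype S] (M : MDP S A) (d₁ : PMF S) (ℓ : ℕ → S → A → ℝ)

theorem sum_detLaw_toReal (π : S → A) (t : ℕ) : ∑ s, (M.detLaw d₁ π t s).toReal = 1 := by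
  rw [← ENNReal.toReal_sum fun s _ => PMF.apply_ne_top _ _, ← tsum_fintype (L := .unconditional _),
    PMF.tsum_coe, ENNReal.toReal_one]

theorem hatLoss_mem_Icc {t : ℕ} (hℓ : ∀ s a, ℓ t s a ∈ Set.Icc (0 : ℝ) 1) (π : S → A) :
    M.hatLoss d₁ ℓ t π ∈ Set.Icc (0 : ℝ) 1 := by
  constructor
  · exact Finset.sum_nonneg fun s _ => mul_nonneg ENNReal.toReal_nonneg (hℓ s _).1
  · rw [← M.sum_detLaw_toReal d₁ π t]
    exact Finset.sum_le_sum fun s _ => mul_le_of_le_one_right ENNReal.toReal_nonneg (hℓ s _).2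

theorem policyLoss_succ (t : ℕ) (π : S → A) :
    M.policyLoss d₁ ℓ (t + 1) π = M.policyLoss d₁ ℓ t π + M.hatLoss d₁ ℓ t π :=
  Finset.sum_range_succ _ _

variable [Fintype A] [Nonempty A]

theorem fpl_le (ε : (S → A) → ℝ) (t : ℕ) (π : S → A) :
    M.policyLoss d₁ ℓ t (M.fpl d₁ ℓ ε t) - ε (M.fpl d₁ ℓ ε t) ≤ M.policyLoss d₁ ℓ t π - ε π := by
  classical
  exact argmin_le (fun π => M.policyLoss d₁ ℓ t π - ε π) π

theorem fpl_eq_of_lt (ε : (S → A) → ℝ) (t : ℕ) {π : S → A}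
    (h : ∀ π', π' ≠ π → M.policyLoss d₁ ℓ t π - ε π < M.policyLoss d₁ ℓ t π' - ε π') :
    M.fpl d₁ ℓ ε t = π := by
  classical
  exact argmin_eq_of_lt (fun π => M.policyLoss d₁ ℓ t π - ε π) h

-- A bonus exceeding the leader's next loss outweighs that loss, while the other policies can only
-- lose more. The strict inequality makes the leader unique, so the tie-breaking rule plays no role.
open Classical in
theorem fpl_update_add {t : ℕ} (hℓ : ∀ s a, ℓ t s a ∈ Set.Icc (0 : ℝ) 1) (ε : (S → A) → ℝ) {x : ℝ}
    {π : S → A} (hx : M.hatLoss d₁ ℓ t π < x) (hπ : M.fpl d₁ ℓ ε t = π) :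
    M.fpl d₁ ℓ (Function.update ε π (ε π + x)) t = π ∧
      M.fpl d₁ ℓ (Function.update ε π (ε π + x)) (t + 1) = π := by
  have h0 := (M.hatLoss_mem_Icc d₁ ℓ hℓ π).1
  constructor <;> refine M.fpl_eq_of_lt d₁ ℓ _ _ fun π' hne => ?_ <;>
    have h1 := M.fpl_le d₁ ℓ ε t π' <;> have h2 := (M.hatLoss_mem_Icc d₁ ℓ hℓ π').1 <;>
    rw [hπ] at h1 <;>
    simp only [Function.update_self, Function.update_of_ne hne, policyLoss_succ] <;> linarith

/-- Be-the-leader induction, with `-ε` acting as the loss of a fictitious round before the first. -/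
theorem sum_hatLoss_fpl_succ_le (ε : (S → A) → ℝ) (T : ℕ) :
    M.policyLoss d₁ ℓ 0 (M.fpl d₁ ℓ ε 0) - ε (M.fpl d₁ ℓ ε 0)
        + ∑ t ∈ Finset.range T, M.hatLoss d₁ ℓ t (M.fpl d₁ ℓ ε (t + 1))
      ≤ M.policyLoss d₁ ℓ T (M.fpl d₁ ℓ ε T) - ε (M.fpl d₁ ℓ ε T) := by
  induction T with
  | zero => simp
  | succ T ih =>
    rw [Finset.sum_range_succ, policyLoss_succ]
    have h := M.fpl_le d₁ ℓ ε T (M.fpl d₁ ℓ ε (T + 1))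
    linarith

theorem exists_policyLoss_eq_bestLoss (T : ℕ) :
    ∃ π : S → A, M.policyLoss d₁ ℓ T π = M.bestLoss d₁ ℓ T := by
  obtain ⟨π, hπ⟩ := Finite.exists_min fun π : S → A => M.policyLoss d₁ ℓ T π
  exact ⟨π, le_antisymm (le_ciInf hπ) (ciInf_le (Set.finite_range _).bddBelow π)⟩

open Classical in
/-- Being the leader against hypothetical knowledge of the next loss. -/
theorem sum_hatLoss_fpl_succ_le_bestLoss {ε : (S → A) → ℝ} (hε : ∀ π, 0 ≤ ε π) (T : ℕ) {r : ℝ}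
    (hr : 0 < r) (c : ℝ) :
    ∑ t ∈ Finset.range T, M.hatLoss d₁ ℓ t (M.fpl d₁ ℓ ε (t + 1)) ≤
      M.bestLoss d₁ ℓ T +
        (c + ∑ π : S → A, 2 / r * Real.exp (-(r * c / 2)) * Real.exp (r * ε π / 2)) := by
  obtain ⟨π, hπ⟩ := M.exists_policyLoss_eq_bestLoss d₁ ℓ T
  have h1 := M.sum_hatLoss_fpl_succ_le d₁ ℓ ε T
  have h2 := M.fpl_le d₁ ℓ ε T π
  have h3 := hε π
  -- The first leader has the largest perturbation. It is bounded through `y - c ≤ (2 / r) exp (r (y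
  -- - c) / 2)`, summed over all policies; the factor `1 / 2` in the exponent keeps the expectation
  -- finite.
  have h4 : ε (M.fpl d₁ ℓ ε 0) - c ≤
      ∑ π : S → A, 2 / r * Real.exp (-(r * c / 2)) * Real.exp (r * ε π / 2) := by
    refine le_trans ?_ (Finset.single_le_sum (f := fun π : S → A =>
      2 / r * Real.exp (-(r * c / 2)) * Real.exp (r * ε π / 2)) (fun π _ => by positivity)
      (Finset.mem_univ (M.fpl d₁ ℓ ε 0)))
    set y := ε (M.fpl d₁ ℓ ε 0)
    rw [mul_assoc, ← Real.exp_add]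
    have h5 := Real.add_one_le_exp (-(r * c / 2) + r * y / 2)
    rw [div_mul_eq_mul_div, le_div_iff₀ hr]
    nlinarith
  have h5 : M.policyLoss d₁ ℓ 0 (M.fpl d₁ ℓ ε 0) = 0 := by simp [policyLoss]
  linarith

/-! ### Stability of the leader and the expected number of switches -/

theorem measurableSet_fpl_eq (t : ℕ) (π : S → A) :
    MeasurableSet {ε : (S → A) → ℝ | M.fpl d₁ ℓ ε t = π} :=
  (M.measurable_fpl_comp d₁ ℓ t) (MeasurableSpace.measurableSet_top (s := {π}))

theorem measurableSet_fpl_stay (t : ℕ) (π : S → A) :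
    MeasurableSet {ε : (S → A) → ℝ | M.fpl d₁ ℓ ε t = π ∧ M.fpl d₁ ℓ ε (t + 1) = π} :=
  (M.measurableSet_fpl_eq d₁ ℓ t π).inter (M.measurableSet_fpl_eq d₁ ℓ (t + 1) π)

/-- The leader remains the leader with high conditional probability. -/
theorem measureReal_fpl_eq_le {t : ℕ} (hℓ : ∀ s a, ℓ t s a ∈ Set.Icc (0 : ℝ) 1) {r : ℝ}
    (hr : 0 < r) (π : S → A) :
    (fplNoise S A r).real {ε | M.fpl d₁ ℓ ε t = π} ≤ Real.exp (r * M.hatLoss d₁ ℓ t π) *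
      (fplNoise S A r).real {ε | M.fpl d₁ ℓ ε t = π ∧ M.fpl d₁ ℓ ε (t + 1) = π} := by
  classical
  have _ := isProbabilityMeasure_fplNoise (S := S) (A := A) hr
  set J := (fplNoise S A r).real {ε | M.fpl d₁ ℓ ε t = π ∧ M.fpl d₁ ℓ ε (t + 1) = π} with hJ
  -- The shift must be strictly larger than the next loss, so the bound is obtained in the limit
  -- from the right.
  have hlim : Filter.Tendsto (fun x => Real.exp (r * x) * J)
      (nhdsWithin (M.hatLoss d₁ ℓ t π) (Set.Ioi (M.hatLoss d₁ ℓ t π)))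
      (nhds (Real.exp (r * M.hatLoss d₁ ℓ t π) * J)) := by
    have : Continuous fun x : ℝ => Real.exp (r * x) * J := by fun_prop
    exact this.continuousAt.tendsto.mono_left nhdsWithin_le_nhds
  refine ge_of_tendsto hlim (Filter.eventually_of_mem self_mem_nhdsWithin fun x hx => ?_)
  have hx' : M.hatLoss d₁ ℓ t π < x := hx
  have hx0 : 0 ≤ x := (M.hatLoss_mem_Icc d₁ ℓ hℓ π).1.trans hx'.le
  have h := pi_expMeasure_le_of_update_add hr hx0 π (M.measurableSet_fpl_eq d₁ ℓ t π)
    (M.measurableSet_fpl_stay d₁ ℓ t π) fun ε hε => M.fpl_update_add d₁ ℓ hℓ ε hx' hε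
  have h' := ENNReal.toReal_mono (ENNReal.mul_ne_top ENNReal.ofReal_ne_top
    (measure_ne_top (fplNoise S A r) _)) h
  rwa [ENNReal.toReal_mul, ENNReal.toReal_ofReal (Real.exp_pos _).le] at h'

theorem integrable_comp_fpl {r : ℝ} (hr : 0 < r) (t t' : ℕ) (F : (S → A) → (S → A) → ℝ) :
    Integrable (fun ε => F (M.fpl d₁ ℓ ε t) (M.fpl d₁ ℓ ε t')) (fplNoise S A r) := by
  have _ := isProbabilityMeasure_fplNoise (S := S) (A := A) hr
  obtain ⟨p, hp⟩ := Finite.exists_max fun p : (S → A) × (S → A) => ‖F p.1 p.2‖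
  refine Integrable.of_bound ?_ ‖F p.1 p.2‖ (Filter.Eventually.of_forall fun ε => hp (_, _))
  let _ : MeasurableSpace (S → A) := ⊤
  have h : Measurable fun ε => (M.fpl d₁ ℓ ε t, M.fpl d₁ ℓ ε t') :=
    (M.measurable_fpl_comp d₁ ℓ t).prodMk (M.measurable_fpl_comp d₁ ℓ t')
  exact ((measurable_of_finite fun p : (S → A) × (S → A) => F p.1 p.2).comp h).aestronglyMeasurable

open Classical in
theorem integral_comp_fpl {r : ℝ} (hr : 0 < r) (t : ℕ) (F : (S → A) → ℝ) :
    ∫ ε, F (M.fpl d₁ ℓ ε t) ∂(fplNoise S A r) =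
      ∑ π : S → A, (fplNoise S A r).real {ε | M.fpl d₁ ℓ ε t = π} * F π := by
  have _ := isProbabilityMeasure_fplNoise (S := S) (A := A) hr
  have h : ∀ ε, F (M.fpl d₁ ℓ ε t) =
      ∑ π : S → A, {ε | M.fpl d₁ ℓ ε t = π}.indicator (fun _ => F π) ε := fun ε => by
    simp [Set.indicator_apply]
  simp only [h]
  rw [integral_finsetSum]
  · refine Finset.sum_congr rfl fun π _ => ?_
    rw [integral_indicator_const _ (M.measurableSet_fpl_eq d₁ ℓ t π), smul_eq_mul]
  · exact fun π _ => (integrable_const _).indicator (M.measurableSet_fpl_eq d₁ ℓ t π)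

open Classical in
theorem integral_fpl_switch {r : ℝ} (hr : 0 < r) (t : ℕ) :
    ∫ ε, (if M.fpl d₁ ℓ ε (t + 1) = M.fpl d₁ ℓ ε t then (0 : ℝ) else 1) ∂(fplNoise S A r) =
      1 - ∑ π : S → A,
        (fplNoise S A r).real {ε | M.fpl d₁ ℓ ε t = π ∧ M.fpl d₁ ℓ ε (t + 1) = π} := by
  have _ := isProbabilityMeasure_fplNoise (S := S) (A := A) hr
  have h : ∀ ε, (if M.fpl d₁ ℓ ε (t + 1) = M.fpl d₁ ℓ ε t then (0 : ℝ) else 1) = 1 -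
      ∑ π : S → A, {ε | M.fpl d₁ ℓ ε t = π ∧ M.fpl d₁ ℓ ε (t + 1) = π}.indicator
        (fun _ => (1 : ℝ)) ε := fun ε => by
    rw [Finset.sum_eq_single (M.fpl d₁ ℓ ε t)]
    · by_cases h : M.fpl d₁ ℓ ε (t + 1) = M.fpl d₁ ℓ ε t <;> simp [h]
    · intro π _ hπ
      simp [Ne.symm hπ]
    · simp
  have hint : ∀ π : S → A, Integrable
      ({ε | M.fpl d₁ ℓ ε t = π ∧ M.fpl d₁ ℓ ε (t + 1) = π}.indicator fun _ => (1 : ℝ))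
      (fplNoise S A r) :=
    fun π => (integrable_const _).indicator (M.measurableSet_fpl_stay d₁ ℓ t π)
  simp only [h]
  rw [integral_sub (integrable_const _) (integrable_finsetSum _ fun π _ => hint π),
    integral_finsetSum _ fun π _ => hint π]
  simp only [integral_const, probReal_univ, smul_eq_mul, mul_one,
    integral_indicator_const _ (M.measurableSet_fpl_stay d₁ ℓ t _)]

-- Given the leader `π`, the probability of a switch is at most `1 - exp (-x) ≤ x`, where `x` is `r`
-- times the next loss of `π`.
open Classical in
theorem integral_fpl_switch_le {t : ℕ} (hℓ : ∀ s a, ℓ t s a ∈ Set.Icc (0 : ℝ) 1) {r : ℝ}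
    (hr : 0 < r) :
    ∫ ε, (if M.fpl d₁ ℓ ε (t + 1) = M.fpl d₁ ℓ ε t then (0 : ℝ) else 1) ∂(fplNoise S A r) ≤
      r * ∫ ε, M.hatLoss d₁ ℓ t (M.fpl d₁ ℓ ε t) ∂(fplNoise S A r) := by
  have _ := isProbabilityMeasure_fplNoise (S := S) (A := A) hr
  have h1 := M.integral_comp_fpl d₁ ℓ hr t fun _ => 1
  simp only [integral_const, probReal_univ, smul_eq_mul, mul_one] at h1
  rw [integral_fpl_switch M d₁ ℓ hr, h1, integral_comp_fpl M d₁ ℓ hr, Finset.mul_sum,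
    ← Finset.sum_sub_distrib]
  refine Finset.sum_le_sum fun π _ => ?_
  have h2 := M.measureReal_fpl_eq_le d₁ ℓ hℓ hr π
  set p := (fplNoise S A r).real {ε | M.fpl d₁ ℓ ε t = π}
  set j := (fplNoise S A r).real {ε | M.fpl d₁ ℓ ε t = π ∧ M.fpl d₁ ℓ ε (t + 1) = π}
  set x := r * M.hatLoss d₁ ℓ t π with hx
  have hp : 0 ≤ p := measureReal_nonneg
  have h3 : Real.exp (-x) * p ≤ j := by
    rw [Real.exp_neg, inv_mul_le_iff₀ (Real.exp_pos _)]
    exact h2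
  have h4 := Real.add_one_le_exp (-x)
  have h5 : r * (p * M.hatLoss d₁ ℓ t π) = x * p := by rw [hx]; ring
  rw [h5]
  nlinarith

/-- Staying the leader implies leading in the next round, so each policy leads at `t` with at most
`exp r` times its probability of leading at `t + 1`. -/
theorem integral_hatLoss_fpl_le_succ {t : ℕ} (hℓ : ∀ s a, ℓ t s a ∈ Set.Icc (0 : ℝ) 1) {r : ℝ}
    (hr : 0 < r) :
    ∫ ε, M.hatLoss d₁ ℓ t (M.fpl d₁ ℓ ε t) ∂(fplNoise S A r) ≤
      Real.exp r * ∫ ε, M.hatLoss d₁ ℓ t (M.fpl d₁ ℓ ε (t + 1)) ∂(fplNoise S A r) := by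
  classical
  have _ := isProbabilityMeasure_fplNoise (S := S) (A := A) hr
  rw [integral_comp_fpl M d₁ ℓ hr, integral_comp_fpl M d₁ ℓ hr, Finset.mul_sum]
  refine Finset.sum_le_sum fun π _ => ?_
  obtain ⟨h0, h1⟩ := M.hatLoss_mem_Icc d₁ ℓ hℓ π
  rw [← mul_assoc]
  refine mul_le_mul_of_nonneg_right ?_ h0
  refine (M.measureReal_fpl_eq_le d₁ ℓ hℓ hr π).trans ?_
  refine mul_le_mul (Real.exp_le_exp.2 (mul_le_of_le_one_right hr.le h1))
    (measureReal_mono fun ε hε => hε.2) measureReal_nonneg (Real.exp_pos _).le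

theorem sum_integral_hatLoss_fpl_succ_le (T : ℕ) {r : ℝ} (hr : 0 < r) :
    ∑ t ∈ Finset.range T, ∫ ε, M.hatLoss d₁ ℓ t (M.fpl d₁ ℓ ε (t + 1)) ∂(fplNoise S A r) ≤
      M.bestLoss d₁ ℓ T + (2 * logPolicies S A + 4) / r := by
  classical
  have _ : IsProbabilityMeasure (expMeasure r) := isProbabilityMeasure_expMeasure hr
  have _ := isProbabilityMeasure_fplNoise (S := S) (A := A) hr
  -- This level makes `|Π| exp (-(r c / 2)) = 1`, so the exponential sum has mean `(2 / r) * 2 = 4 /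
  -- r`.
  set c := 2 * logPolicies S A / r with hc
  have hpres := fun π => measurePreserving_eval (fun _ : S → A => expMeasure r) π
  have hint : ∀ π : S → A, Integrable (fun ε : (S → A) → ℝ =>
      2 / r * Real.exp (-(r * c / 2)) * Real.exp (r * ε π / 2)) (fplNoise S A r) := fun π =>
    ((hpres π).integrable_comp_of_integrable (integrable_exp_half_expMeasure hr)).const_mul _
  have hval : ∀ π : S → A, ∫ ε : (S → A) → ℝ, Real.exp (r * ε π / 2) ∂(fplNoise S A r) = 2 :=
    fun π => by
      refine Eq.trans ?_ (integral_exp_half_expMeasure hr)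
      rw [← (hpres π).map_eq, integral_map]
      · rfl
      · exact (measurable_pi_apply π).aemeasurable
      · exact Continuous.aestronglyMeasurable (by fun_prop)
  have hN : (Fintype.card (S → A) : ℝ) * Real.exp (-(r * c / 2)) = 1 := by
    rw [show r * c / 2 = logPolicies S A by rw [hc]; field_simp, ← card_policies, Real.exp_neg,
      Real.exp_log (by exact_mod_cast Fintype.card_pos)]
    exact mul_inv_cancel₀ (by exact_mod_cast Fintype.card_ne_zero)
  rw [← integral_finsetSum _ fun t _ =>
    M.integrable_comp_fpl d₁ ℓ hr (t + 1) (t + 1) fun π _ => M.hatLoss d₁ ℓ t π]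
  refine (integral_mono_ae (integrable_finsetSum _ fun t _ =>
    M.integrable_comp_fpl d₁ ℓ hr (t + 1) (t + 1) fun π _ => M.hatLoss d₁ ℓ t π)
    (((integrable_const _).add ((integrable_const _).add (integrable_finsetSum _ fun π _ =>
      hint π)))) (by
    filter_upwards [ae_nonneg_fplNoise (S := S) (A := A) hr] with ε hε
    exact M.sum_hatLoss_fpl_succ_le_bestLoss d₁ ℓ hε T hr c)).trans_eq ?_
  have h1 : Integrable (fun ε : (S → A) → ℝ => ∑ π : S → A,
      2 / r * Real.exp (-(r * c / 2)) * Real.exp (r * ε π / 2)) (fplNoise S A r) :=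
    integrable_finsetSum _ fun π _ => hint π
  have h2 := integral_add (integrable_const c) h1
  have h3 := integral_add (integrable_const (M.bestLoss d₁ ℓ T)) ((integrable_const c).add h1)
  simp only [Pi.add_apply] at h2 h3 ⊢
  rw [h3, h2, integral_finsetSum _ fun π _ => hint π]
  simp only [integral_const, probReal_univ, smul_eq_mul, one_mul, integral_const_mul, hval,
    Finset.sum_const, Finset.card_univ, nsmul_eq_mul]
  rw [show (Fintype.card (S → A) : ℝ) * (2 / r * Real.exp (-(r * c / 2)) * 2) =
    4 / r * (Fintype.card (S → A) * Real.exp (-(r * c / 2))) by ring, hN, hc]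
  ring

theorem sum_integral_hatLoss_fpl_le {T : ℕ}
    (hℓ : ∀ t < T, ∀ s a, ℓ t s a ∈ Set.Icc (0 : ℝ) 1) {r : ℝ} (hr : 0 < r) :
    ∑ t ∈ Finset.range T, ∫ ε, M.hatLoss d₁ ℓ t (M.fpl d₁ ℓ ε t) ∂(fplNoise S A r) ≤
      Real.exp r * (M.bestLoss d₁ ℓ T + (2 * logPolicies S A + 4) / r) := by
  refine le_trans ?_ (mul_le_mul_of_nonneg_left
    (M.sum_integral_hatLoss_fpl_succ_le d₁ ℓ T hr) (Real.exp_pos r).le)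
  rw [Finset.mul_sum]
  exact Finset.sum_le_sum fun t ht =>
    M.integral_hatLoss_fpl_le_succ d₁ ℓ (hℓ t (Finset.mem_range.1 ht)) hr

open Classical in
theorem sum_integral_fpl_switch_le {T : ℕ}
    (hℓ : ∀ t < T, ∀ s a, ℓ t s a ∈ Set.Icc (0 : ℝ) 1) {r : ℝ} (hr : 0 < r) :
    ∑ t ∈ Finset.range T,
        ∫ ε, (if M.fpl d₁ ℓ ε (t + 1) = M.fpl d₁ ℓ ε t then (0 : ℝ) else 1) ∂(fplNoise S A r) ≤
      r * ∑ t ∈ Finset.range T, ∫ ε, M.hatLoss d₁ ℓ t (M.fpl d₁ ℓ ε t) ∂(fplNoise S A r) := by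
  rw [Finset.mul_sum]
  exact Finset.sum_le_sum fun t ht =>
    M.integral_fpl_switch_le d₁ ℓ (hℓ t (Finset.mem_range.1 ht)) hr

end

end MDP

namespace MDP

variable {S A : Type*}

/-! ### Policies of least expected hitting time -/

open Classical in
/-- The probabilities `notHitProb` as continuous functions of the action probabilities. -/
noncomputable def notHitNN [Fintype S] [Fintype A] (M : MDP S A) (g : S) (f : S → A → NNReal) :
    ℕ → S → NNReal
  | 0, s => if s = g then 0 else 1
  | n + 1, s =>
      if s = g then 0 else ∑ a, f s a * ∑ s', (M.P s a s').toNNReal * notHitNN M g f n s'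

theorem continuous_notHitNN [Fintype S] [Fintype A] (M : MDP S A) (g : S) (n : ℕ) (s : S) :
    Continuous fun f : S → A → NNReal => M.notHitNN g f n s := by
  induction n generalizing s with
  | zero => exact continuous_const
  | succ n ih =>
    simp only [notHitNN]
    split_ifs <;> fun_prop

theorem coe_notHitNN [Fintype S] [Fintype A] (M : MDP S A) (g : S) (f : S → A → NNReal)
    (π : S → PMF A) (h : ∀ s a, (f s a : ℝ≥0∞) = π s a) (n : ℕ) (s : S) :
    (M.notHitNN g f n s : ℝ≥0∞) = M.notHitProb π g n s := by
  classical
  induction n generalizing s with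
  | zero => simp only [notHitNN, notHitProb]; split_ifs <;> simp
  | succ n ih =>
    simp only [notHitNN, notHitProb]
    split_ifs
    · simp
    · simp [h, ih, ENNReal.coe_toNNReal (PMF.apply_ne_top _ _)]

/-- The expected hitting time is a sum of nonnegative continuous functions of the action
probabilities, hence lower semicontinuous even where it is infinite. It attains its minimum on the
compact product of simplices. -/
theorem exists_expHit_le [Fintype S] [Fintype A] [Nonempty A] (M : MDP S A) (s g : S) :
    ∃ π : S → PMF A, ∀ π' : S → PMF A, M.expHit π s g ≤ M.expHit π' s g := by
  classical
  let X : Set (S → A → NNReal) := {f | ∀ s, ∑ a, f s a = 1}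
  have hclosed : IsClosed X := by
    simp only [X, Set.ofPred_forall]
    exact isClosed_iInter fun s => isClosed_eq (by fun_prop) continuous_const
  have hsub : X ⊆ Set.univ.pi fun _ : S => Set.univ.pi fun _ : A => Set.Icc (0 : NNReal) 1 := by
    intro f hf s _ a _
    exact ⟨zero_le, (hf s) ▸ Finset.single_le_sum (f := f s) (fun _ _ => zero_le)
      (Finset.mem_univ a)⟩
  have hcomp : IsCompact X := (isCompact_univ_pi fun _ => isCompact_univ_pi fun _ =>
    isCompact_Icc).of_isClosed_subset hclosed hsub
  have hmem : ∀ π : S → PMF A, (fun s a => (π s a).toNNReal) ∈ X := fun π s => by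
    have h := (π s).tsum_coe
    rw [tsum_fintype] at h
    rw [← ENNReal.toNNReal_sum fun a _ => PMF.apply_ne_top _ _, h, ENNReal.toNNReal_one]
  have hne : X.Nonempty := ⟨_, hmem fun _ => PMF.pure (Classical.arbitrary A)⟩
  have hlsc : LowerSemicontinuous fun f : S → A → NNReal =>
      ∑' n, (M.notHitNN g f n s : ℝ≥0∞) :=
    lowerSemicontinuous_tsum fun n =>
      (ENNReal.continuous_coe.comp (M.continuous_notHitNN g n s)).lowerSemicontinuous
  obtain ⟨f, hf, hmin⟩ := (hlsc.lowerSemicontinuousOn X).exists_isMinOn hne hcomp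
  let π : S → PMF A := fun s => PMF.ofFintype (fun a => (f s a : ℝ≥0∞)) (by exact_mod_cast hf s)
  refine ⟨π, fun π' => ?_⟩
  have h1 := hmin (hmem π')
  simp only [Set.mem_ofPred_eq] at h1
  simp only [expHit]
  rwa [tsum_congr fun n => M.coe_notHitNN g f π (fun s a => rfl) n s,
    tsum_congr fun n => M.coe_notHitNN g _ π'
      (fun s a => ENNReal.coe_toNNReal (PMF.apply_ne_top _ _)) n s] at h1

theorem exists_expHit_le_ediam [Fintype S] [Fintype A] [Nonempty A] (M : MDP S A) {s g : S}
    (hsg : s ≠ g) : ∃ π : S → PMF A, M.expHit π s g ≤ M.ediam := by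
  obtain ⟨π, hπ⟩ := M.exists_expHit_le s g
  refine ⟨π, (le_iInf hπ).trans ?_⟩
  exact le_iSup_of_le s (le_iSup_of_le g (le_iSup_of_le hsg le_rfl))

/-! ### Existence of admissible plans -/

theorem stateLaw_add (M : MDP S A) (μ : PMF S) (π : ℕ → S → PMF A) (m n : ℕ) :
    M.stateLaw μ π (m + n) = M.stateLaw (M.stateLaw μ π m) (fun k => π (m + k)) n := by
  induction n with
  | zero => rfl
  | succ n ih => rw [← add_assoc, stateLaw, ih, stateLaw]

theorem stateLaw_congr (M : MDP S A) (μ : PMF S) {π π' : ℕ → S → PMF A} (n : ℕ)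
    (h : ∀ k < n, π k = π' k) : M.stateLaw μ π n = M.stateLaw μ π' n := by
  induction n with
  | zero => rfl
  | succ n ih => rw [stateLaw, ih fun k hk => h k (by omega), h n (by omega), stateLaw]

theorem stateLaw_bind (M : MDP S A) (μ : PMF S) (π : ℕ → S → PMF A) (n : ℕ) :
    M.stateLaw μ π n = μ.bind fun s => M.stateLaw (PMF.pure s) π n := by
  induction n with
  | zero => exact (PMF.bind_pure μ).symm
  | succ n ih => rw [stateLaw, ih, PMF.bind_bind]; rfl

/-- `stateLaw` recurses on the last step; splitting off the first one instead matches the recursion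
of `notHitProb`. -/
theorem stateLaw_succ_eq (M : MDP S A) (s : S) (π : S → PMF A) (n : ℕ) (g : S) :
    M.stateLaw (PMF.pure s) (fun _ => π) (n + 1) g = (π s).lexp fun a => (M.P s a).lexp fun s' =>
      M.stateLaw (PMF.pure s') (fun _ => π) n g := by
  rw [add_comm, stateLaw_add, stateLaw_bind, PMF.bind_apply_eq_lexp]
  simp only [stateLaw, PMF.pure_bind, PMF.lexp_bind]

theorem notHitProb_le_one [Fintype S] [Fintype A] (M : MDP S A) (π : S → PMF A) (g : S) (n : ℕ)
    (s : S) : M.notHitProb π g n s ≤ 1 := by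
  induction n generalizing s with
  | zero => simp only [notHitProb]; split_ifs <;> simp
  | succ n ih =>
    rw [notHitProb_succ]
    split_ifs
    · simp
    · exact PMF.lexp_le_const _ fun a => PMF.lexp_le_const _ ih

theorem antitone_notHitProb [Fintype S] [Fintype A] (M : MDP S A) (π : S → PMF A) (g s : S) :
    Antitone fun n => M.notHitProb π g n s := by
  refine antitone_nat_of_succ_le fun n => ?_
  induction n generalizing s with
  | zero =>
    by_cases h : s = g
    · simp [notHitProb_succ, h]
    · exact (M.notHitProb_le_one π g 1 s).trans (by simp [notHitProb, h])
  | succ n ih =>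
    rw [notHitProb_succ, notHitProb_succ]
    split_ifs
    · simp
    · exact PMF.lexp_mono _ fun a => PMF.lexp_mono _ ih

/-- If `g` is missed up to time `n` but not up to `n + 1`, the state at time `n + 1` is `g`. -/
theorem notHitProb_le_add [Fintype S] [Fintype A] (M : MDP S A) (π : S → PMF A) (g : S) (n : ℕ)
    (s : S) : M.notHitProb π g n s ≤
      M.notHitProb π g (n + 1) s + M.stateLaw (PMF.pure s) (fun _ => π) (n + 1) g := by
  classical
  induction n generalizing s with
  | zero =>
    by_cases h : s = g
    · simp [notHitProb, h]
    · rw [notHitProb_succ, if_neg h, stateLaw_succ_eq, ← PMF.lexp_add]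
      simp only [← PMF.lexp_add]
      refine (M.notHitProb_le_one π g 0 s).trans ?_
      rw [← PMF.lexp_const (π s) 1]
      refine PMF.lexp_mono _ fun a => ?_
      rw [← PMF.lexp_const (M.P s a) 1]
      refine PMF.lexp_mono _ fun s' => ?_
      by_cases h' : s' = g <;> simp [notHitProb, stateLaw, h']
  | succ n ih =>
    by_cases h : s = g
    · simp [notHitProb, h]
    · rw [notHitProb_succ, notHitProb_succ M π g (n + 1), if_neg h, if_neg h, stateLaw_succ_eq,
        ← PMF.lexp_add]
      simp only [← PMF.lexp_add]
      exact PMF.lexp_mono _ fun a => PMF.lexp_mono _ fun s' => ih s'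

theorem stateLaw_stay (M : MDP S A) {sstar : S} {a₀ : A} (h : M.P sstar a₀ = PMF.pure sstar)
    (n : ℕ) : M.stateLaw (PMF.pure sstar) (fun _ _ => PMF.pure a₀) n = PMF.pure sstar := by
  induction n with
  | zero => rfl
  | succ n ih => rw [stateLaw, ih, PMF.pure_bind, PMF.pure_bind, h]

/-- Were all these probabilities below `1 / (4 D)`, a union bound would leave `g` unvisited up to
time `L ≤ 2 D` with probability at least `1 / 2`. The first `L + 1` tail probabilities would then
add up to at least `(L + 1) / 2 > D`. -/
theorem exists_hit_exactly [Fintype S] [Fintype A] (M : MDP S A) {s g : S}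
    (hsg : s ≠ g) {D : ℝ} (hD : 0 < D) {π : S → PMF A} (hπ : M.expHit π s g ≤ ENNReal.ofReal D)
    {L : ℕ} (hL : L ≤ 2 * D) (hL' : 2 * D < L + 1) :
    ∃ k ≤ L, 1 / (4 * D) ≤ (M.stateLaw (PMF.pure s) (fun _ => π) k g).toReal := by
  by_contra! hcon
  have hfin : ∀ n, M.notHitProb π g n s ≠ ∞ := fun n =>
    ne_top_of_le_ne_top ENNReal.one_ne_top (M.notHitProb_le_one π g n s)
  have h1 : ((L : ℝ) + 1) * (M.notHitProb π g L s).toReal ≤ D := by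
    have h2 : ∑ _n ∈ Finset.range (L + 1), M.notHitProb π g L s ≤ M.expHit π s g :=
      (Finset.sum_le_sum fun n hn => M.antitone_notHitProb π g s
        (Nat.lt_succ_iff.1 (Finset.mem_range.1 hn))).trans (ENNReal.sum_le_tsum _)
    have h3 := ENNReal.toReal_mono ENNReal.ofReal_ne_top (h2.trans hπ)
    rw [ENNReal.toReal_ofReal hD.le] at h3
    rwa [Finset.sum_const, Finset.card_range, nsmul_eq_mul, ENNReal.toReal_mul,
      ENNReal.toReal_natCast, Nat.cast_succ] at h3
  have h4 : ∀ n ≤ L, 1 - n * (1 / (4 * D)) ≤ (M.notHitProb π g n s).toReal := by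
    intro n
    induction n with
    | zero => simp [notHitProb, hsg]
    | succ n ih =>
      intro hn
      have h5 := ENNReal.toReal_mono
        (ENNReal.add_ne_top.2 ⟨hfin (n + 1), PMF.apply_ne_top _ _⟩) (M.notHitProb_le_add π g n s)
      rw [ENNReal.toReal_add (hfin _) (PMF.apply_ne_top _ _)] at h5
      have h6 := hcon (n + 1) hn
      have h7 := ih (by omega)
      push_cast
      linarith
  have h8 := h4 L le_rfl
  have h9 : (L : ℝ) * (1 / (4 * D)) ≤ 1 / 2 := by
    rw [mul_one_div, div_le_iff₀ (by positivity)]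
    linarith
  nlinarith

theorem one_le_diam [Fintype S] [Fintype A] [Nontrivial S] {M : MDP S A} (h : M.Communicating) :
    1 ≤ M.diam := by
  have h' := ENNReal.toReal_mono h.ne M.one_le_ediam
  rwa [ENNReal.toReal_one] at h'

theorem ofReal_diam [Fintype S] [Fintype A] {M : MDP S A} (h : M.Communicating) :
    ENNReal.ofReal M.diam = M.ediam :=
  ENNReal.ofReal_toReal h.ne

/-- The self-loop is used to wait at `s^*` until exactly `k` steps remain, with `k` the good hitting
time; then the policy of least expected hitting time takes over. For `g = s^*` waiting alone
suffices. -/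
theorem exists_chase [Fintype S] [Fintype A] [Nontrivial S] [Nonempty A] {M : MDP S A}
    (hM : M.Communicating) {sstar : S} {a₀ : A} (h : M.P sstar a₀ = PMF.pure sstar) (g : S) :
    ∃ c : ℕ → S → PMF A,
      1 / (4 * M.diam) ≤ (M.stateLaw (PMF.pure sstar) c ⌊2 * M.diam⌋₊ g).toReal := by
  have hD := one_le_diam hM
  by_cases hg : sstar = g
  · refine ⟨fun _ _ => PMF.pure a₀, ?_⟩
    rw [M.stateLaw_stay h, hg, PMF.pure_apply_self, ENNReal.toReal_one, div_le_iff₀ (by linarith)]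
    linarith
  · obtain ⟨π, hπ⟩ := M.exists_expHit_le_ediam hg
    rw [← ofReal_diam hM] at hπ
    obtain ⟨k, hk, hp⟩ := M.exists_hit_exactly hg (by linarith) hπ
      (Nat.floor_le (by linarith : 0 ≤ 2 * M.diam)) (Nat.lt_floor_add_one _)
    refine ⟨fun n s => if n < ⌊2 * M.diam⌋₊ - k then PMF.pure a₀ else π s, ?_⟩
    generalize hw : ⌊2 * M.diam⌋₊ - k = w
    rw [show ⌊2 * M.diam⌋₊ = w + k by omega, stateLaw_add,
      M.stateLaw_congr _ w (π' := fun _ _ => PMF.pure a₀) fun n hn => by simp [hn],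
      M.stateLaw_stay h]
    simpa using hp

theorem exists_isAdmissible [Fintype S] [Fintype A] [Nontrivial S] [Nonempty A] {M : MDP S A}
    (hM : M.Communicating) {sstar : S} {a₀ : A} (h : M.P sstar a₀ = PMF.pure sstar) :
    ∃ plan : CatchPlan S A, plan.IsAdmissible M sstar := by
  choose home hhome using fun s => M.exists_expHit_le s sstar
  choose chase hchase using exists_chase hM h
  have hD := one_le_diam hM
  exact ⟨⟨home, ⌊2 * M.diam⌋₊, chase⟩, fun s _ π => hhome s π,
    Nat.floor_le (by linarith), hchase⟩

end MDP

namespace MDP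

variable {S A : Type*}

/-! ### The regret of the algorithm -/

theorem CatchPlan.IsAdmissible.catchProb_ne_zero [Fintype S] [Fintype A] [Nontrivial S]
    {M : MDP S A} (hM : M.Communicating) {sstar : S} {plan : CatchPlan S A}
    (hplan : plan.IsAdmissible M sstar) (g : S) : M.catchProb sstar plan g ≠ 0 := by
  intro h
  have h1 := hplan.le_catchProb g
  rw [h, ENNReal.toReal_zero] at h1
  have h2 : 0 < M.diam := by linarith [one_le_diam hM]
  have h3 : 0 < 1 / (4 * M.diam) := by positivity
  linarith

/-- With `len = 0` no target other than `s^*` could be met, and `S` has such a target. -/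
theorem CatchPlan.IsAdmissible.len_pos [Fintype S] [Fintype A] [Nontrivial S]
    {M : MDP S A} (hM : M.Communicating) {sstar : S} {plan : CatchPlan S A}
    (hplan : plan.IsAdmissible M sstar) : 0 < plan.len := by
  obtain ⟨g, hg⟩ := exists_ne sstar
  refine Nat.pos_of_ne_zero fun h => hplan.catchProb_ne_zero hM g ?_
  rw [catchProb, h, stateLaw, PMF.pure_apply_of_ne _ _ hg]

/-- The constants are `B = 12 D ^ 2` and `K = D + B`. Success with probability at least `1 / (4 D)`
saves at least `K / (4 D) = 1 / 4 + 3 D`, which covers `len ≤ 2 D` and the difference `K - B = D`.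
-/
theorem CatchPlan.IsAdmissible.len_add_le [Fintype S] [Fintype A] [Nontrivial S]
    {M : MDP S A} (hM : M.Communicating) {sstar : S} {plan : CatchPlan S A}
    (hplan : plan.IsAdmissible M sstar) :
    plan.len + ENNReal.ofReal (M.diam + 12 * M.diam ^ 2) * (1 - M.catchProbMin sstar plan) ≤
      ENNReal.ofReal (12 * M.diam ^ 2) := by
  have hD := one_le_diam hM
  have hlen := hplan.len_le
  have hp : ENNReal.ofReal (1 / (4 * M.diam)) ≤ M.catchProbMin sstar plan :=
    le_iInf fun g => (ENNReal.ofReal_le_iff_le_toReal (PMF.apply_ne_top _ _)).2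
      (hplan.le_catchProb g)
  have hq : (0 : ℝ) ≤ 1 - 1 / (4 * M.diam) := by
    rw [sub_nonneg, div_le_one (by linarith)]
    linarith
  have h1 : 1 - M.catchProbMin sstar plan ≤ ENNReal.ofReal (1 - 1 / (4 * M.diam)) := by
    rw [ENNReal.ofReal_sub _ (by positivity), ENNReal.ofReal_one]
    exact tsub_le_tsub_left hp 1
  refine (add_le_add le_rfl (mul_le_mul_right h1 _)).trans ?_
  rw [← ENNReal.ofReal_natCast, ← ENNReal.ofReal_mul (by positivity),
    ← ENNReal.ofReal_add (by positivity) (by positivity)]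
  refine ENNReal.ofReal_le_ofReal ?_
  have h2 : (M.diam + 12 * M.diam ^ 2) * (1 - 1 / (4 * M.diam)) =
      M.diam + 12 * M.diam ^ 2 - 1 / 4 - 3 * M.diam := by
    field_simp
    ring
  rw [h2]
  linarith

theorem CatchPlan.IsAdmissible.expHit_home_add_le [Fintype S] [Fintype A] {M : MDP S A}
    (hM : M.Communicating) {sstar : S} {plan : CatchPlan S A}
    (hplan : plan.IsAdmissible M sstar) {s : S} (hs : s ≠ sstar) :
    M.expHit (plan.home s) s sstar + ENNReal.ofReal (12 * M.diam ^ 2) ≤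
      ENNReal.ofReal (M.diam + 12 * M.diam ^ 2) := by
  rw [ENNReal.ofReal_add (p := M.diam) ENNReal.toReal_nonneg (by positivity), ofReal_diam hM]
  refine add_le_add ((le_iInf (hplan.home_best s hs)).trans ?_) le_rfl
  exact le_iSup_of_le s (le_iSup_of_le sstar (le_iSup_of_le hs le_rfl))

-- Each switch costs at most `D + 12 D ^ 2` idle rounds in expectation, and this is at most `13 D ^
-- 2` because `D ≥ 1`.
open Classical in
theorem lossGiven_le [Fintype S] [Fintype A] [Nontrivial S] {M : MDP S A} (hM : M.Communicating)
    (d₁ : PMF S) {sstar : S} {plan : CatchPlan S A} (hplan : plan.IsAdmissible M sstar) {T : ℕ}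
    {ℓ : ℕ → S → A → ℝ} (hℓ : ∀ t < T, ∀ s a, ℓ t s a ∈ Set.Icc (0 : ℝ) 1) (seq : ℕ → S → A) :
    M.lossGiven d₁ sstar plan ℓ T seq ≤ ∑ t ∈ Finset.range T, M.hatLoss d₁ ℓ t (seq t) +
      13 * M.diam ^ 2 * ∑ t ∈ Finset.range T, if seq (t + 1) = seq t then 0 else 1 := by
  have hD := one_le_diam hM
  have hlen := hplan.len_pos hM
  have hpos := hplan.catchProb_ne_zero hM
  have h1 := M.sum_idle_le d₁ sstar plan hlen hpos (hplan.len_add_le hM)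
    (ENNReal.ofReal_le_ofReal (by linarith)) (fun s hs => hplan.expHit_home_add_le hM hs) seq T
  have hidle : ∀ t ∈ Finset.range T,
      (M.configLaw d₁ sstar plan seq t).lexp (fun c => c.2.idle) ≠ ∞ := fun t _ =>
    ne_top_of_le_ne_top ENNReal.one_ne_top (lexp_idle_le_one _)
  have hite : ∀ t ∈ Finset.range T, (if seq (t + 1) = seq t then (0 : ℝ≥0∞) else 1) ≠ ∞ :=
    fun t _ => by split_ifs <;> simp
  have h2 := ENNReal.toReal_mono
    (ENNReal.mul_ne_top ENNReal.ofReal_ne_top (ENNReal.sum_ne_top.2 hite)) h1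
  rw [ENNReal.toReal_sum hidle, ENNReal.toReal_mul, ENNReal.toReal_sum hite,
    ENNReal.toReal_ofReal (by positivity)] at h2
  have h3 : ∀ t, (if seq (t + 1) = seq t then (0 : ℝ≥0∞) else 1).toReal =
      if seq (t + 1) = seq t then (0 : ℝ) else 1 := fun t => by split_ifs <;> simp
  simp only [h3] at h2
  have h4 : M.lossGiven d₁ sstar plan ℓ T seq ≤ ∑ t ∈ Finset.range T, M.hatLoss d₁ ℓ t (seq t) +
      ∑ t ∈ Finset.range T,
        ((M.configLaw d₁ sstar plan seq t).lexp fun c => c.2.idle).toReal := by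
    rw [lossGiven, ← Finset.sum_add_distrib]
    exact Finset.sum_le_sum fun t ht => M.sum_stateActionLaw_le d₁ sstar plan hlen hpos seq t
      (hℓ t (Finset.mem_range.1 ht))
  have h5 : 0 ≤ ∑ t ∈ Finset.range T, if seq (t + 1) = seq t then (0 : ℝ) else 1 :=
    Finset.sum_nonneg fun t _ => by split_ifs <;> simp
  have h6 : M.diam + 12 * M.diam ^ 2 ≤ 13 * M.diam ^ 2 := by nlinarith
  have h7 := mul_le_mul_of_nonneg_right h6 h5
  linarith

theorem lossGiven_le_natCast [Fintype S] [Fintype A] (M : MDP S A) (d₁ : PMF S) (sstar : S)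
    (plan : CatchPlan S A) {T : ℕ} {ℓ : ℕ → S → A → ℝ}
    (hℓ : ∀ t < T, ∀ s a, ℓ t s a ∈ Set.Icc (0 : ℝ) 1) (seq : ℕ → S → A) :
    M.lossGiven d₁ sstar plan ℓ T seq ≤ T := by
  have h : ∀ t ∈ Finset.range T, ∑ x : S × A,
      (M.stateActionLaw d₁ sstar plan seq t x).toReal * ℓ t x.1 x.2 ≤ 1 := fun t ht => by
    have h1 := (M.stateActionLaw d₁ sstar plan seq t).tsum_coe
    rw [tsum_fintype] at h1
    rw [← ENNReal.toReal_one, ← h1, ENNReal.toReal_sum fun x _ => PMF.apply_ne_top _ _]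
    exact Finset.sum_le_sum fun x _ => mul_le_of_le_one_right ENNReal.toReal_nonneg
      (hℓ t (Finset.mem_range.1 ht) _ _).2
  simpa [lossGiven] using Finset.sum_le_sum h

theorem bestLoss_mem_Icc [Fintype S] [Fintype A] [Nonempty A] (M : MDP S A) (d₁ : PMF S) {T : ℕ}
    {ℓ : ℕ → S → A → ℝ} (hℓ : ∀ t < T, ∀ s a, ℓ t s a ∈ Set.Icc (0 : ℝ) 1) :
    M.bestLoss d₁ ℓ T ∈ Set.Icc (0 : ℝ) T := by
  obtain ⟨π, hπ⟩ := M.exists_policyLoss_eq_bestLoss d₁ ℓ T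
  rw [← hπ]
  have h := fun t ht => M.hatLoss_mem_Icc d₁ ℓ (hℓ t (Finset.mem_range.1 ht)) π
  exact ⟨Finset.sum_nonneg fun t ht => (h t ht).1,
    by simpa [policyLoss] using Finset.sum_le_sum fun t ht => (h t ht).2⟩

theorem regret_le_natCast [Fintype S] [Fintype A] [Nonempty A] (M : MDP S A) (d₁ : PMF S)
    (sstar : S) (plan : CatchPlan S A) {T : ℕ} {ℓ : ℕ → S → A → ℝ}
    (hℓ : ∀ t < T, ∀ s a, ℓ t s a ∈ Set.Icc (0 : ℝ) 1) {r : ℝ} (hr : 0 < r) :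
    M.regret d₁ sstar plan r ℓ T ≤ T := by
  have _ := isProbabilityMeasure_fplNoise (S := S) (A := A) hr
  have h1 : M.algLoss d₁ sstar plan r ℓ T ≤ T := by
    refine (integral_mono (M.integrable_lossGiven d₁ sstar plan hr ℓ T)
      (integrable_const (T : ℝ)) fun ε =>
        M.lossGiven_le_natCast d₁ sstar plan hℓ (M.fpl d₁ ℓ ε)).trans_eq ?_
    simp
  have h2 := (M.bestLoss_mem_Icc d₁ hℓ).1
  rw [regret]
  linarith

theorem algLoss_le [Fintype S] [Fintype A] [Nontrivial S] [Nonempty A] {M : MDP S A}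
    (hM : M.Communicating) (d₁ : PMF S) {sstar : S} {plan : CatchPlan S A}
    (hplan : plan.IsAdmissible M sstar) {T : ℕ} {ℓ : ℕ → S → A → ℝ}
    (hℓ : ∀ t < T, ∀ s a, ℓ t s a ∈ Set.Icc (0 : ℝ) 1) {r : ℝ} (hr : 0 < r) :
    M.algLoss d₁ sstar plan r ℓ T ≤ (1 + 13 * M.diam ^ 2 * r) *
      ∑ t ∈ Finset.range T, ∫ ε, M.hatLoss d₁ ℓ t (M.fpl d₁ ℓ ε t) ∂(fplNoise S A r) := by
  classical
  have hint1 : ∀ t ∈ Finset.range T,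
      Integrable (fun ε => M.hatLoss d₁ ℓ t (M.fpl d₁ ℓ ε t)) (fplNoise S A r) := fun t _ =>
    M.integrable_comp_fpl d₁ ℓ hr t t fun π _ => M.hatLoss d₁ ℓ t π
  have hint2 : ∀ t ∈ Finset.range T, Integrable
      (fun ε => if M.fpl d₁ ℓ ε (t + 1) = M.fpl d₁ ℓ ε t then (0 : ℝ) else 1)
      (fplNoise S A r) := fun t _ =>
    M.integrable_comp_fpl d₁ ℓ hr (t + 1) t fun π π' => if π = π' then 0 else 1
  have h1 := integral_mono (M.integrable_lossGiven d₁ sstar plan hr ℓ T)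
    ((integrable_finsetSum _ hint1).add
      ((integrable_finsetSum _ hint2).const_mul (13 * M.diam ^ 2)))
    fun ε => lossGiven_le hM d₁ hplan hℓ (M.fpl d₁ ℓ ε)
  have h2 := integral_add (integrable_finsetSum _ hint1)
      ((integrable_finsetSum _ hint2).const_mul (13 * M.diam ^ 2))
  simp only [Pi.add_apply] at h1 h2
  rw [h2, integral_const_mul, integral_finsetSum _ hint1, integral_finsetSum _ hint2] at h1
  refine h1.trans ?_
  have h3 := mul_le_mul_of_nonneg_left (M.sum_integral_fpl_switch_le d₁ ℓ hℓ hr)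
    (by positivity : 0 ≤ 13 * M.diam ^ 2)
  linarith

/-- The regret bound for an arbitrary parameter. -/
theorem regret_le [Fintype S] [Fintype A] [Nontrivial S] [Nonempty A] {M : MDP S A}
    (hM : M.Communicating) (d₁ : PMF S) {sstar : S} {plan : CatchPlan S A}
    (hplan : plan.IsAdmissible M sstar) {T : ℕ} {ℓ : ℕ → S → A → ℝ}
    (hℓ : ∀ t < T, ∀ s a, ℓ t s a ∈ Set.Icc (0 : ℝ) 1) {r : ℝ} (hr : 0 < r) (hr' : r ≤ 1 / 2) :
    M.regret d₁ sstar plan r ℓ T ≤ 2 * (r * M.bestLoss d₁ ℓ T) + 8 * ((1 + logPolicies S A) / r)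
      + 26 * M.diam ^ 2 * (r * M.bestLoss d₁ ℓ T + 4 * (1 + logPolicies S A)) := by
  have hD := one_le_diam hM
  have hg := logPolicies_nonneg S A
  have hL := (M.bestLoss_mem_Icc d₁ hℓ).1
  have h1 := algLoss_le hM d₁ hplan hℓ hr
  have h2 := M.sum_integral_hatLoss_fpl_le d₁ ℓ hℓ hr
  rw [regret]
  set F := ∑ t ∈ Finset.range T, ∫ ε, M.hatLoss d₁ ℓ t (M.fpl d₁ ℓ ε t) ∂(fplNoise S A r)
  set L := M.bestLoss d₁ ℓ T
  set b := 1 + logPolicies S A with hb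
  have hb0 : 0 < b := by linarith
  -- From `exp (-r) ≥ 1 - r` one gets `exp r ≤ 1 / (1 - r)`, which is at most `1 + 2 r` for `r ≤ 1 /
  -- 2`.
  have hexp : Real.exp r ≤ 1 + 2 * r := by
    have h3 := Real.add_one_le_exp (-r)
    rw [Real.exp_neg, ← one_div, le_div_iff₀ (Real.exp_pos r)] at h3
    have h4 := Real.exp_pos r
    nlinarith
  have h5 : (2 * logPolicies S A + 4) / r ≤ 4 * (b / r) := by
    rw [← mul_div_assoc]
    exact div_le_div_of_nonneg_right (by linarith) hr.le
  have hbr : 0 < b / r := by positivity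
  have h6 : F ≤ (1 + 2 * r) * (L + 4 * (b / r)) :=
    h2.trans (mul_le_mul hexp (by linarith) (by positivity) (by linarith))
  have h7 : r * (b / r) = b := by field_simp
  have h8 : F ≤ L + 2 * (r * L) + 8 * (b / r) := by nlinarith
  have h9 : r * F ≤ 2 * (r * L + 4 * b) := by
    calc r * F ≤ r * ((1 + 2 * r) * (L + 4 * (b / r))) := mul_le_mul_of_nonneg_left h6 hr.le
      _ = (1 + 2 * r) * (r * L + 4 * (r * (b / r))) := by ring
      _ ≤ 2 * (r * L + 4 * (r * (b / r))) :=
        mul_le_mul_of_nonneg_right (by linarith) (by positivity)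
      _ = 2 * (r * L + 4 * b) := by rw [h7]
  have h10 := mul_le_mul_of_nonneg_left h9 (by positivity : 0 ≤ 13 * M.diam ^ 2)
  linarith

/-! ### Tuning of the rate and conclusion -/

theorem regret_fplRate_le [Fintype S] [Fintype A] [Nontrivial S] [Nonempty A] {M : MDP S A}
    (hM : M.Communicating) (d₁ : PMF S) {sstar : S} {plan : CatchPlan S A}
    (hplan : plan.IsAdmissible M sstar) {T : ℕ} {ℓ : ℕ → S → A → ℝ}
    (hℓ : ∀ t < T, ∀ s a, ℓ t s a ∈ Set.Icc (0 : ℝ) 1) {Λ : ℝ} (hΛ : M.bestLoss d₁ ℓ T ≤ Λ) :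
    M.regret d₁ sstar plan (fplRate S A Λ) ℓ T ≤
      134 * M.diam ^ 2 * √((1 + logPolicies S A) * max Λ (1 + logPolicies S A)) := by
  have hD := one_le_diam hM
  have hg := logPolicies_nonneg S A
  have hb0 : 0 < 1 + logPolicies S A := by linarith
  have hr := fplRate_pos S A Λ
  have hbm := le_max_right Λ (1 + logPolicies S A)
  have hLm := hΛ.trans (le_max_left Λ (1 + logPolicies S A))
  have hreg := fun hr' => regret_le hM d₁ hplan hℓ hr hr'
  unfold fplRate at *
  set b := 1 + logPolicies S A
  set m := max Λ b
  set L := M.bestLoss d₁ ℓ T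
  have hm0 : 0 < m := hb0.trans_le hbm
  have hsb := Real.sqrt_pos.2 hb0
  have hsm := Real.sqrt_pos.2 hm0
  have hb2 := Real.mul_self_sqrt hb0.le
  have hm2 := Real.mul_self_sqrt hm0.le
  have hle := Real.sqrt_le_sqrt hbm
  rw [Real.sqrt_div' _ hm0.le] at *
  rw [Real.sqrt_mul hb0.le]
  set x := √b
  set y := √m
  -- The maximum in the definition of the rate gives `b ≤ m`, which brings it into the range of
  -- `regret_le`.
  have h1 : x / y / 2 ≤ 1 / 2 :=
    div_le_div_of_nonneg_right ((div_le_one hsm).2 hle) (by norm_num)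
  refine (hreg h1).trans ?_
  have h2 : x / y / 2 * L ≤ x * y / 2 := by
    refine (mul_le_mul_of_nonneg_left hLm hr.le).trans_eq ?_
    rw [← hm2]
    field_simp
  have h3 : b / (x / y / 2) = 2 * (x * y) := by
    rw [← hb2]
    field_simp
  have h4 : b ≤ x * y := hb2 ▸ mul_le_mul_of_nonneg_left hle hsb.le
  rw [h3]
  have hxy : 0 < x * y := by positivity
  have hD2 : 1 ≤ M.diam ^ 2 := one_le_pow₀ hD
  -- Here `r L ≤ x y / 2` and `b ≤ x y`, so the three terms contribute `1`, `16` and `26 * 9 / 2 =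
  -- 117` times `x y`, up to `D ^ 2`: in total `134`.
  have h5 : 26 * M.diam ^ 2 * (x / y / 2 * L + 4 * b) ≤ 26 * M.diam ^ 2 * (9 / 2 * (x * y)) :=
    mul_le_mul_of_nonneg_left (by linarith) (by positivity)
  have h6 : x * y ≤ M.diam ^ 2 * (x * y) := le_mul_of_one_le_left hxy.le hD2
  linarith

/-- With a single policy FPL never switches, so there are no idle rounds. -/
theorem regret_nonpos_of_subsingleton [Fintype S] [Fintype A] [Nontrivial S] [Nonempty A]
    [Subsingleton A] {M : MDP S A} (hM : M.Communicating) (d₁ : PMF S) {sstar : S}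
    {plan : CatchPlan S A} (hplan : plan.IsAdmissible M sstar) {T : ℕ} {ℓ : ℕ → S → A → ℝ}
    (hℓ : ∀ t < T, ∀ s a, ℓ t s a ∈ Set.Icc (0 : ℝ) 1) {r : ℝ} (hr : 0 < r) :
    M.regret d₁ sstar plan r ℓ T ≤ 0 := by
  have _ := isProbabilityMeasure_fplNoise (S := S) (A := A) hr
  obtain ⟨π, hπ⟩ := M.exists_policyLoss_eq_bestLoss d₁ ℓ T
  have h1 : M.algLoss d₁ sstar plan r ℓ T ≤ M.policyLoss d₁ ℓ T π := by
    refine (integral_mono (M.integrable_lossGiven d₁ sstar plan hr ℓ T)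
      (integrable_const (M.policyLoss d₁ ℓ T π)) fun ε => ?_).trans_eq (by simp)
    refine (lossGiven_le hM d₁ hplan hℓ (M.fpl d₁ ℓ ε)).trans_eq ?_
    simp [policyLoss, Subsingleton.elim (M.fpl d₁ ℓ ε _) π]
  rw [regret]
  linarith

/-- Since `2 log 2 > 1`. This absorbs the summand `1` of `1 + log |Π|` into a factor `2`. -/
theorem one_le_logPolicies [Fintype S] [Fintype A] [Nontrivial S] [Nontrivial A] :
    1 ≤ logPolicies S A := by
  have hS : (2 : ℝ) ≤ Fintype.card S := by exact_mod_cast Fintype.one_lt_card (α := S)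
  have hA : (2 : ℝ) ≤ Fintype.card A := by exact_mod_cast Fintype.one_lt_card (α := A)
  have h1 := Real.log_le_log (by norm_num) hA
  have h2 := Real.log_two_gt_d9
  rw [logPolicies]
  nlinarith

end MDP

theorem sqrt_mul_le_two_mul_sqrt {a b c : ℝ} (h : a ≤ 4 * (b * c)) : √a ≤ 2 * √(b * c) := by
  refine (Real.sqrt_le_sqrt h).trans_eq ?_
  rw [Real.sqrt_mul (by norm_num), show (4 : ℝ) = 2 ^ 2 by norm_num, Real.sqrt_sq (by norm_num)]

theorem mainTheorem5 :
    ∃ C : ℝ, 0 < C ∧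
      ∀ (S A : Type*) [Fintype S] [Fintype A] [Nontrivial S] [Nonempty A]
        (M : MDP S A) (d₁ : PMF S) (sstar : S) (a₀ : A),
        M.Communicating → M.P sstar a₀ = PMF.pure sstar →
        (∃ plan : MDP.CatchPlan S A, plan.IsAdmissible M sstar) ∧
        ∀ plan : MDP.CatchPlan S A, plan.IsAdmissible M sstar →
        ∀ (T : ℕ) (ℓ : ℕ → S → A → ℝ), (∀ t < T, ∀ s a, ℓ t s a ∈ Set.Icc (0 : ℝ) 1) →
          M.regret d₁ sstar plan (fplRate S A T) ℓ T
              ≤ C * M.diam ^ 2 * √((T : ℝ) * (Fintype.card S * Real.log (Fintype.card A))) ∧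
          (Fintype.card S * Real.log (Fintype.card A) ≤ M.bestLoss d₁ ℓ T →
            M.regret d₁ sstar plan (fplRate S A (M.bestLoss d₁ ℓ T)) ℓ T
              ≤ C * M.diam ^ 2 *
                √(M.bestLoss d₁ ℓ T * (Fintype.card S * Real.log (Fintype.card A)))) ∧
          M.regret d₁ sstar plan (fplRate S A (M.bestLoss d₁ ℓ T)) ℓ T
            ≤ C * M.diam ^ 2 *
              (√(M.bestLoss d₁ ℓ T * (Fintype.card S * Real.log (Fintype.card A)))
                + Fintype.card S * Real.log (Fintype.card A)) := by
  -- `268 = 2 * 134`: replacing `(1 + g) * max Λ (1 + g)` by the target quantity costs a factor of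
  -- at most `4` under the root.
  refine ⟨268, by norm_num, ?_⟩
  intro S A _ _ _ _ M d₁ sstar a₀ hM ha₀
  refine ⟨MDP.exists_isAdmissible hM ha₀, fun plan hplan T ℓ hℓ => ?_⟩
  have hg0 := logPolicies_nonneg S A
  have hD := MDP.one_le_diam hM
  have hD2 : 1 ≤ M.diam ^ 2 := one_le_pow₀ hD
  obtain ⟨hL0, hLT⟩ := M.bestLoss_mem_Icc d₁ hℓ
  change _ ≤ 268 * M.diam ^ 2 * √((T : ℝ) * logPolicies S A) ∧ (logPolicies S A ≤ _ →
    _ ≤ 268 * M.diam ^ 2 * √(M.bestLoss d₁ ℓ T * logPolicies S A)) ∧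
    _ ≤ 268 * M.diam ^ 2 * (√(M.bestLoss d₁ ℓ T * logPolicies S A) + logPolicies S A)
  -- For one action `log |A| = 0` and the first two bounds, like the summand of the third,
  -- degenerate to `0`, so this case needs regret at most `0`.
  rcases subsingleton_or_nontrivial A with hA | hA
  · have h := fun Λ => MDP.regret_nonpos_of_subsingleton hM d₁ hplan hℓ (fplRate_pos S A Λ)
    exact ⟨(h _).trans (by positivity), fun _ => (h _).trans (by positivity),
      (h _).trans (by positivity)⟩
  have hg : 1 ≤ logPolicies S A := MDP.one_le_logPolicies
  have hT := MDP.regret_fplRate_le hM d₁ hplan hℓ hLT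
  have hL := MDP.regret_fplRate_le hM d₁ hplan hℓ le_rfl
  have hreg := M.regret_le_natCast d₁ sstar plan hℓ (fplRate_pos S A T)
  set g := logPolicies S A
  set L := M.bestLoss d₁ ℓ T
  have hT0 : (0 : ℝ) ≤ T := Nat.cast_nonneg T
  have hscale : ∀ {x y : ℝ}, x ≤ 2 * y →
      134 * M.diam ^ 2 * x ≤ 268 * M.diam ^ 2 * y := fun {x y} h => by
    have := mul_le_mul_of_nonneg_left h (by positivity : 0 ≤ 134 * M.diam ^ 2)
    linarith
  refine ⟨?_, fun hgL => ?_, ?_⟩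
  · rcases le_total (1 + g) T with hb | hb
    · refine hT.trans (hscale (sqrt_mul_le_two_mul_sqrt ?_))
      rw [max_eq_left hb]
      nlinarith
    -- For short horizons the trivial bound `T` on the regret suffices, as `T ≤ 1 + g ≤ 2 g`.
    · have h1 : (T : ℝ) ≤ 2 * √(T * g) := by
        refine le_trans (le_of_eq (Real.sqrt_mul_self hT0).symm) (sqrt_mul_le_two_mul_sqrt ?_)
        nlinarith
      have h2 : √(T * g) ≤ M.diam ^ 2 * √(T * g) :=
        le_mul_of_one_le_left (Real.sqrt_nonneg _) hD2
      have h3 := Real.sqrt_nonneg (T * g)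
      linarith
  · refine hL.trans (hscale (sqrt_mul_le_two_mul_sqrt ?_))
    have h1 : max L (1 + g) ≤ 2 * L := max_le (by linarith) (by linarith)
    calc (1 + g) * max L (1 + g) ≤ (2 * g) * (2 * L) :=
          mul_le_mul (by linarith) h1 (hL0.trans (le_max_left _ _)) (by linarith)
      _ = 4 * (L * g) := by ring
  · refine hL.trans (hscale ?_)
    have hs := Real.sqrt_nonneg (L * g)
    have hs2 := Real.mul_self_sqrt (mul_nonneg hL0 hg0)
    rw [Real.sqrt_le_left (by positivity)]
    have h1 : max L (1 + g) ≤ L + 2 * g := max_le (by linarith) (by linarith)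
    calc (1 + g) * max L (1 + g) ≤ (2 * g) * (L + 2 * g) :=
          mul_le_mul (by linarith) h1 (hL0.trans (le_max_left _ _)) (by linarith)
      _ ≤ (2 * (√(L * g) + g)) ^ 2 := by nlinarith [mul_nonneg hs hg0]
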